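/- **Setting.** Let $\mathcal X$ be a measurable space, $[c]=\{1,\dots,c\}$ with $c\ge 1$ the set of class labels, and $\mathcal F$ a finite nonempty set of measurable node functions $f:\mathcal X\to\{0,1\}$. A dataset with $n$ examples is $D=(X,y)\in\mathcal X^n\times[c]^n$. For a leaf $l$ of a decision tree $T$ whose internal nodes are labeled by elements of $\mathcal F$ and whose leaves are labeled by classes, let $w(l)$ be the number of examples of $D$ that map to $l$, and $p_i(l)$ the fraction of those that are labeled $i$. Let $T_{l\to f}$ be the tree obtained from $T$ by replacing the leaf $l$ by an internal node labeled $f$ with two leaf children, each labeled by the most frequent label among the examples of $D$ that map to it. For $\alpha>0$ and an integer $\beta\ge 1$, the $(\alpha,\beta)$-Tsallis entropy of a probability vector $P=(p_1,\dots,p_c)$ is $$g_{\alpha,\beta}(P)=\frac{C}{\alpha-1}\Big(1-\Big(\sum_{i=1}^c p_i^{\alpha}\Big)^{\beta}\Big)\quad(\alpha\ne1),\qquad g_{1,\beta}(P)=\lim_{\alpha\to1}g_{\alpha,\beta}(P)=-C\beta\sum_{i=1}^c p_i\log p_i ,$$ where $C>0$ is a normalizing constant, which may depend on $(\alpha,\beta)$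 (at $\alpha=1$ its value there is used). The splitting function is $G_{\alpha,\beta}(T)=\sum_{l\in\mathrm{leaves}(T)}w(l)\,g_{\alpha,\beta}(\{p_i(l)\}_{i=1}^c)$. On input $D$, the top-down learner starts with a single leaf labeled by the most frequent label in $D$ and repeatedly replaces the current tree $T$ by $T_{l^*\to f^*}$ with $(l^*,f^*)\in\mathrm{argmin}_{l\in\mathrm{leaves}(T),\,f\in\mathcal F}G_{\alpha,\beta}(T_{l\to f})$. Ties among the optimal $(l,f)$ are resolved by an arbitrary fixed rule that depends only on the current tree and on the set of optimal pairs, and ties among most frequent labels by an arbitrary fixed rule that depends only on the set of these labels. Let $t\ge1$ be the size parameter. The learner stops when the tree has $s$ internal nodes, where $s\le t+1$ is any fixed number (for example $s=t$, or $s=t+1$ for the loop "while $T$ has at most $t$ internal nodes"). Denote the learned tree by $T_{\mathcal F,(\alpha,\beta),t}(D)$ and let $L(\alpha,\beta;D)=\frac1n\sum_{i=1}^n\mathbf I[T_{\mathcal F,(\alpha,\beta),t}(D)(X_i)\ne y_i]$ be its 0-1 loss on $D$. **Theorem.** There is a universal constant $K>0$ such that the following holds for all $\mathcal X$, $n$,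 $c\ge1$, $\mathcal F$, $t\ge1$, $s\le t+1$, all tie-breaking rules and normalizing constants as above, every integer $B\ge1$, and every probability distribution $\mathcal D$ over datasets with $n$ examples. The expected loss $\mathbb E_{D\sim\mathcal D}L(\alpha,\beta;D)$ has a minimizer $(\alpha^*,\beta^*)$ over $\alpha>0$, $\beta\in[B]$, and for all datasets $D_1,\dots,D_N$ the empirical loss $\sum_{j=1}^N L(\alpha,\beta;D_j)$ has a minimizer over $\alpha>0$, $\beta\in[B]$. For all $\epsilon,\delta>0$ and every $N$ with $$N\ \ge\ \frac{K}{\epsilon^2}\Big(t\big(\log|\mathcal F|+\log t+c\log(B+c)\big)+\log\frac1\delta\Big),$$ with probability at least $1-\delta$ over independent samples $D_1,\dots,D_N\sim\mathcal D$, every minimizer $(\hat\alpha,\hat\beta)$ of the empirical loss over $\alpha>0$, $\beta\in[B]$ (every choice of ERM parameters) satisfies $$\mathbb E_{D\sim\mathcal D}L(\hat\alpha,\hat\beta;D)\ \le\ \mathbb E_{D\sim\mathcal D}L(\alpha^*,\beta^*;D)+\epsilon .$$ -/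

import Mathlib

open MeasureTheory

universe u

/-- Binary decision trees over an input domain `X`: internal nodes carry a Boolean node function,
leaves carry one of `c` class labels. A point `x` goes left at a node `f` when `f x = false` and
right when `f x = true`. -/
inductive DecisionTree (X : Type u) (c : ℕ) : Type u
  | leaf (y : Fin c) : DecisionTree X c
  | node (f : X → Bool) (left right : DecisionTree X c) : DecisionTree X c

namespace DecisionTree

variable {X : Type u} {c : ℕ}

/-- The label of the leaf that `x` reaches. -/
def predict : DecisionTree X c → X → Fin c
  | leaf y, _ => y
  | node f l r, x => if f x then r.predict x else l.predict x

/-- The address of the leaf that `x` reaches, as the list of turns taken from the root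
(`false` is left, `true` is right). -/
def leafOf : DecisionTree X c → X → List Bool
  | leaf _, _ => []
  | node f l r, x => if f x then true :: r.leafOf x else false :: l.leafOf x

/-- The addresses of all leaves. -/
def leaves : DecisionTree X c → Finset (List Bool)
  | leaf _ => {[]}
  | node _ l r => l.leaves.image (List.cons false) ∪ r.leaves.image (List.cons true)

/-- The number of internal nodes. -/
def internalNodes : DecisionTree X c → ℕ
  | leaf _ => 0
  | node _ l r => l.internalNodes + r.internalNodes + 1

/-- Replace the leaf with the given address by the tree `S` (no change if the address is not that
of a leaf). -/
def replaceLeaf (S : DecisionTree X c) : DecisionTree X c → List Bool → DecisionTree X c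
  | leaf _, [] => S
  | node f l r, false :: p => node f (replaceLeaf S l p) r
  | node f l r, true :: p => node f l (replaceLeaf S r p)
  | T, _ => T

theorem internalNodes_replaceLeaf (f : X → Bool) (y z : Fin c) (T : DecisionTree X c)
    (p : List Bool) (hp : p ∈ T.leaves) :
    (replaceLeaf (node f (leaf y) (leaf z)) T p).internalNodes = T.internalNodes + 1 := by
  induction T generalizing p with
  | leaf w =>
    simp only [leaves, Finset.mem_singleton] at hp
    subst hp
    simp [replaceLeaf, internalNodes]
  | node g l r ihl ihr =>
    simp only [leaves, Finset.mem_union, Finset.mem_image] at hp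
    rcases hp with ⟨q, hq, rfl⟩ | ⟨q, hq, rfl⟩
    · simp only [replaceLeaf, internalNodes, ihl q hq]; omega
    · simp only [replaceLeaf, internalNodes, ihr q hq]; omega

theorem leaves_nonempty (T : DecisionTree X c) : T.leaves.Nonempty := by
  induction T with
  | leaf w => exact ⟨[], by simp [leaves]⟩
  | node g l r ihl _ =>
    obtain ⟨q, hq⟩ := ihl
    exact ⟨false :: q, by simp [leaves, hq]⟩

end DecisionTree

/-- Labeled datasets `D = (X, y)` with `n` examples from the domain `X` and labels among `c`
classes. -/
abbrev Dataset (X : Type u) (c n : ℕ) : Type u := (Fin n → X) × (Fin n → Fin c)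

/-- A deterministic rule for resolving ties: which of several optimal pairs (leaf, node function)
is used to split the current tree, and which of several most frequent labels is put on a leaf. -/
structure TieBreaking (X : Type u) (c : ℕ) where
  chooseSplit : DecisionTree X c → Finset (List Bool × (X → Bool)) → List Bool × (X → Bool)
  chooseSplit_mem : ∀ T s, s.Nonempty → chooseSplit T s ∈ s
  chooseLabel : Finset (Fin c) → Fin c
  chooseLabel_mem : ∀ s, s.Nonempty → chooseLabel s ∈ s

noncomputable section

namespace TopDown

variable {X : Type u} {c n : ℕ}

/-- The number of indices in `I` whose example has label `y`. -/
def labelCount (D : Dataset X c n) (I : Finset (Fin n)) (y : Fin c) : ℕ :=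
  (I.filter fun i => D.2 i = y).card

/-- The most frequent label among the examples with index in `I`. -/
def majorityLabel (tb : TieBreaking X c) (D : Dataset X c n) (I : Finset (Fin n)) : Fin c :=
  tb.chooseLabel (Finset.univ.filter fun y => ∀ z, labelCount D I z ≤ labelCount D I y)

/-- The indices of the examples of `D` that map to the leaf `l` of `T`. -/
def dataAt (D : Dataset X c n) (T : DecisionTree X c) (l : List Bool) : Finset (Fin n) :=
  Finset.univ.filter fun i => T.leafOf (D.1 i) = l

/-- The weight `w(l)`: the number of examples that map to the leaf `l`. -/
def weight (D : Dataset X c n) (T : DecisionTree X c) (l : List Bool) : ℕ :=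
  (dataAt D T l).card

/-- `p_y(l)`: the fraction of examples labeled `y` among those that map to the leaf `l`
(its value at a leaf without examples is irrelevant, as such a leaf has weight `0`). -/
def labelFraction (D : Dataset X c n) (T : DecisionTree X c) (l : List Bool) (y : Fin c) : ℝ :=
  (labelCount D (dataAt D T l) y : ℝ) / (weight D T l : ℝ)

/-- The splitting function `G(T) = ∑_{l ∈ leaves(T)} w(l) g({p_i(l)}_i)`. -/
def splittingFunction (g : (Fin c → ℝ) → ℝ) (D : Dataset X c n) (T : DecisionTree X c) : ℝ :=
  ∑ l ∈ T.leaves, (weight D T l : ℝ) * g (labelFraction D T l)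

/-- The tree `T_{l → f}`: the leaf `l` becomes an internal node labeled `f` with two leaf
children, each labeled by the most frequent label among the examples mapped to it. -/
def splitLeaf (tb : TieBreaking X c) (D : Dataset X c n) (T : DecisionTree X c)
    (l : List Bool) (f : X → Bool) : DecisionTree X c :=
  T.replaceLeaf (S := .node f
    (.leaf (majorityLabel tb D ((dataAt D T l).filter fun i => f (D.1 i) = false)))
    (.leaf (majorityLabel tb D ((dataAt D T l).filter fun i => f (D.1 i) = true)))) l

open Classical in
/-- The set `argmin_{l ∈ leaves(T), f ∈ F} G(T_{l → f})`. -/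
def bestSplits (tb : TieBreaking X c) (F : Finset (X → Bool)) (g : (Fin c → ℝ) → ℝ)
    (D : Dataset X c n) (T : DecisionTree X c) : Finset (List Bool × (X → Bool)) :=
  (T.leaves ×ˢ F).filter fun p => ∀ q ∈ T.leaves ×ˢ F,
    splittingFunction g D (splitLeaf tb D T p.1 p.2) ≤
      splittingFunction g D (splitLeaf tb D T q.1 q.2)

/-- The top-down decision tree learner after `s` rounds. Each round replaces one leaf by an
internal node, so the result has exactly `s` internal nodes when `F` is nonempty
(`internalNodes_learn`). -/
def learn (tb : TieBreaking X c) (F : Finset (X → Bool)) (g : (Fin c → ℝ) → ℝ)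
    (D : Dataset X c n) : ℕ → DecisionTree X c
  | 0 => .leaf (majorityLabel tb D Finset.univ)
  | s + 1 =>
    let T := learn tb F g D s
    let p := tb.chooseSplit T (bestSplits tb F g D T)
    splitLeaf tb D T p.1 p.2

theorem bestSplits_nonempty (tb : TieBreaking X c) (F : Finset (X → Bool)) (hF : F.Nonempty)
    (g : (Fin c → ℝ) → ℝ) (D : Dataset X c n) (T : DecisionTree X c) :
    (bestSplits tb F g D T).Nonempty := by
  obtain ⟨p, hp, hmin⟩ := Finset.exists_min_image (T.leaves ×ˢ F)
    (fun p => splittingFunction g D (splitLeaf tb D T p.1 p.2))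
    (T.leaves_nonempty.product hF)
  exact ⟨p, by
    unfold bestSplits
    exact Finset.mem_filter.2 ⟨hp, hmin⟩⟩

theorem internalNodes_learn (tb : TieBreaking X c) (F : Finset (X → Bool)) (hF : F.Nonempty)
    (g : (Fin c → ℝ) → ℝ) (D : Dataset X c n) (s : ℕ) :
    (learn tb F g D s).internalNodes = s := by
  induction s with
  | zero => rfl
  | succ s ih =>
    have h := tb.chooseSplit_mem (learn tb F g D s) _
      (bestSplits_nonempty tb F hF g D (learn tb F g D s))
    have h1 := (Finset.mem_product.1 (Finset.mem_filter.1 h).1).1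
    simp only [learn, splitLeaf]
    rw [DecisionTree.internalNodes_replaceLeaf _ _ _ _ _ h1, ih]

/-- The 0-1 loss `L(T, D)`: the fraction of examples of `D` that `T` misclassifies. -/
def zeroOneLoss (T : DecisionTree X c) (D : Dataset X c n) : ℝ :=
  ((Finset.univ.filter fun i => T.predict (D.1 i) ≠ D.2 i).card : ℝ) / (n : ℝ)

end TopDown

/-- The `(α, β)`-Tsallis entropy with normalizing constant `C`; at `α = 1` it is given by its limit
as `α → 1`, which is `C β` times the Shannon entropy. -/
def tsallisEntropy {c : ℕ} (C α : ℝ) (β : ℕ) (p : Fin c → ℝ) : ℝ :=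
  if α = 1 then C * β * ∑ i, Real.negMulLog (p i)
  else C / (α - 1) * (1 - (∑ i, p i ^ α) ^ β)

/-- The loss on the dataset `D` of the tree with `s` internal nodes that the top-down learner,
run with the `(α, β)`-Tsallis criterion, learns from `D`. The normalizing constant is allowed to
depend on the parameters. -/
def tsallisLoss {X : Type u} {c n : ℕ} (tb : TieBreaking X c) (F : Finset (X → Bool))
    (C : ℝ → ℕ → ℝ) (s : ℕ) (α : ℝ) (β : ℕ) (D : Dataset X c n) : ℝ :=
  TopDown.zeroOneLoss (TopDown.learn tb F (tsallisEntropy (C α β) α β) D s) D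

/-- `(a, b)` minimizes `Φ` over all `α > 0` and `β ∈ {1, …, B}`. -/
def IsArgminParam (B : ℕ) (Φ : ℝ → ℕ → ℝ) (a : ℝ) (b : ℕ) : Prop :=
  0 < a ∧ b ∈ Finset.Icc 1 B ∧ ∀ α : ℝ, 0 < α → ∀ β ∈ Finset.Icc 1 B, Φ a b ≤ Φ α β

end

/-! The proof bounds the complexity of the family of losses in `α` independently of `n`, and then
applies a uniform law of large numbers without a factor `log (1 / ε)`.

Complexity: fix a dataset and `β`. By the multinomial theorem, `(∑ p_i ^ α) ^ β` is a sum of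
exponentials `exp (l α)` with at most `(β + 1) ^ c` frequencies `l`. Away from `α = 1`, comparing
two candidate splits therefore means finding the sign of an exponential sum with few frequencies,
and by Rolle such a sum has fewer zeros than frequencies (`card_zeros_expSum_lt`). Few trees can
occur in `s` rounds under any criterion, so the zeros of all relevant comparisons, together with `α
= 1`, cut the `α`-axis into pieces on which the learned tree is constant
(`exists_breakpoints_learn`). The logarithm of the number `M` of breakpoints is of the order in the
theorem.

Statistics: a random piecewise constant function with at most `M` breakpoints has on average at most
`M` of them. Cutting the parameter axis into about `2M / γ` cells of small expected breakpoint mass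
gives brackets of size `γ` (`exists_brackets`). Bracketing numbers `V / γ` allow chaining over the
scales `2 ^ (-j)` with Bernstein-type tails, so that order `(log V + log (1 / δ)) / ε ^ 2` samples
make all deviations at most `ε / 2` (`exists_bad_of_brackets`). The usual two-sided comparison then
bounds the excess risk of every empirical minimizer by `ε`.

Minimizers exist, and losses are measurable, because the learner sees a dataset only through its
labels and the values of the node functions, a finite amount of information. -/

/-! ### Zeros and signs of exponential sums. -/

/-- A nontrivial real exponential sum with frequencies in `E` has fewer than `E.card` zeros. -/
theorem card_zeros_expSum_lt (E : Finset ℝ) (a : ℝ → ℝ) (ha : ∃ l ∈ E, a l ≠ 0) (Z : Finset ℝ)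
    (hZ : ∀ z ∈ Z, ∑ l ∈ E, a l * Real.exp (l * z) = 0) : Z.card < E.card := by
  induction E using Finset.induction_on generalizing a Z with
  | empty => simp at ha
  | insert k E hk ih =>
    rw [Finset.card_insert_of_notMem hk]
    by_cases hE : ∃ l ∈ E, a l ≠ 0
    -- Division by `exp (k x)` turns the `k`-term into a constant. Differentiation removes it and
    -- leaves a shifted sum over `E` with coefficients `a l * (l - k)`, which are not all zero.
    · set f : ℝ → ℝ := fun x => a k + ∑ l ∈ E, a l * Real.exp ((l - k) * x) with hf
      set f' : ℝ → ℝ := fun x => ∑ l ∈ E, a l * (Real.exp ((l - k) * x) * (l - k)) with hf'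
      have hder : ∀ x, HasDerivAt f (f' x) x := by
        intro x
        refine HasDerivAt.const_add _ (HasDerivAt.fun_sum fun l _ => ?_)
        refine HasDerivAt.const_mul _ ?_
        simpa using ((hasDerivAt_id x).const_mul (l - k)).exp
      have hfz : ∀ z ∈ Z, f z = 0 := by
        intro z hz
        have h := hZ z hz
        rw [Finset.sum_insert hk] at h
        have : f z = Real.exp (-(k * z)) *
            (a k * Real.exp (k * z) + ∑ l ∈ E, a l * Real.exp (l * z)) := by
          simp only [hf, mul_add, Finset.mul_sum]
          congr 1
          · rw [mul_left_comm, ← Real.exp_add]; simp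
          · refine Finset.sum_congr rfl fun l _ => ?_
            rw [mul_left_comm, ← Real.exp_add]; congr 2; ring
        rw [this, h, mul_zero]
      have key : ∀ W : Finset ℝ, (∀ z ∈ W, f' z = 0) → W.card < E.card := by
        intro W hW
        refine ih (fun l => a l * (l - k)) (by
          obtain ⟨l, hl, hal⟩ := hE
          exact ⟨l, hl, mul_ne_zero hal (sub_ne_zero.2 fun h => hk (h ▸ hl))⟩) W fun z hz => ?_
        have : ∑ l ∈ E, a l * (l - k) * Real.exp (l * z) = Real.exp (k * z) * f' z := by
          simp only [hf', Finset.mul_sum]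
          refine Finset.sum_congr rfl fun l _ => ?_
          have : Real.exp (l * z) = Real.exp (k * z) * Real.exp ((l - k) * z) := by
            rw [← Real.exp_add]; congr 1; ring
          rw [this]; ring
        rw [this, hW z hz, mul_zero]
      have hfin : {x | f' x = 0}.Finite := by
        by_contra hinf
        obtain ⟨W, hW, hcard⟩ := Set.Infinite.exists_subset_card_eq hinf E.card
        exact (key W fun z hz => hW hz).ne hcard
      have h1 : hfin.toFinset.card < E.card := key _ fun z hz => by simpa using hz
      -- Rolle: between two zeros of `f` lies a zero of `f'`.
      have h2 : Z.card ≤ hfin.toFinset.card + 1 := by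
        refine Finset.card_le_of_interleaved fun x hx y hy hxy _ => ?_
        obtain ⟨z, hz, hz0⟩ := exists_hasDerivAt_eq_zero hxy
          (fun w _ => (hder w).continuousAt.continuousWithinAt)
          ((hfz x hx).trans (hfz y hy).symm) (fun w _ => hder w)
        exact ⟨z, by simpa using hz0, hz.1, hz.2⟩
      omega
    · push Not at hE
      have hak : a k ≠ 0 := by
        obtain ⟨l, hl, hal⟩ := ha
        rcases Finset.mem_insert.1 hl with rfl | hl
        · exact hal
        · exact absurd (hE l hl) hal
      have : Z = ∅ := by
        refine Finset.eq_empty_of_forall_notMem fun z hz => ?_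
        have h := hZ z hz
        rw [Finset.sum_insert hk, Finset.sum_eq_zero fun l hl => by rw [hE l hl, zero_mul],
          add_zero] at h
        exact mul_ne_zero hak (Real.exp_pos _).ne' h
      simp [this]

/-- `h` agrees on the positive reals with an exponential sum with frequencies in `E`. -/
def IsExpSum (E : Finset ℝ) (h : ℝ → ℝ) : Prop :=
  ∃ a : ℝ → ℝ, ∀ x, 0 < x → h x = ∑ l ∈ E, a l * Real.exp (l * x)

namespace IsExpSum

variable {E E' : Finset ℝ} {h h' : ℝ → ℝ}

theorem mono (hh : IsExpSum E h) (hE : E ⊆ E') : IsExpSum E' h := by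
  classical
  obtain ⟨a, ha⟩ := hh
  refine ⟨fun l => if l ∈ E then a l else 0, fun x hx => ?_⟩
  rw [ha x hx]
  simp only [ite_mul, zero_mul]
  rw [← Finset.sum_filter, Finset.filter_mem_eq_inter, Finset.inter_eq_right.2 hE]

theorem sub (hh : IsExpSum E h) (hh' : IsExpSum E h') : IsExpSum E fun x => h x - h' x := by
  obtain ⟨a, ha⟩ := hh
  obtain ⟨b, hb⟩ := hh'
  exact ⟨fun l => a l - b l, fun x hx => by
    simp only [ha x hx, hb x hx, sub_mul, Finset.sum_sub_distrib]⟩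

theorem const_mul (r : ℝ) (hh : IsExpSum E h) : IsExpSum E fun x => r * h x := by
  obtain ⟨a, ha⟩ := hh
  exact ⟨fun l => r * a l, fun x hx => by
    simp only [ha x hx, Finset.mul_sum, mul_assoc]⟩

theorem sum {ι : Type*} (s : Finset ι) {g : ι → ℝ → ℝ} (hg : ∀ i ∈ s, IsExpSum E (g i)) :
    IsExpSum E fun x => ∑ i ∈ s, g i x := by
  classical
  induction s using Finset.induction_on with
  | empty => exact ⟨0, fun x _ => by simp⟩
  | insert i s hi ih =>
    obtain ⟨a, ha⟩ := hg i (Finset.mem_insert_self _ _)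
    obtain ⟨b, hb⟩ := ih fun j hj => hg j (Finset.mem_insert_of_mem hj)
    exact ⟨fun l => a l + b l, fun x hx => by
      have hbx : ∑ j ∈ s, g j x = _ := hb x hx
      simp only [Finset.sum_insert hi, ha x hx, hbx, add_mul, Finset.sum_add_distrib]⟩

theorem exp {l : ℝ} (hl : l ∈ E) : IsExpSum E fun x => Real.exp (l * x) := by
  classical
  exact ⟨fun k => if k = l then 1 else 0, fun x _ => by simp [hl]⟩

/-- The sign of an exponential sum on the positive reals changes only at few points. -/
theorem exists_sign_eq (hh : IsExpSum E h) :
    ∃ Z : Finset ℝ, Z.card ≤ E.card ∧ ∀ x y, 0 < x → x < y → (∀ z ∈ Z, x ≤ z → y < z) →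
      SignType.sign (h x) = SignType.sign (h y) := by
  obtain ⟨a, ha⟩ := hh
  set f : ℝ → ℝ := fun x => ∑ l ∈ E, a l * Real.exp (l * x) with hf
  by_cases hE : ∃ l ∈ E, a l ≠ 0
  · have hfin : {x | f x = 0}.Finite := by
      by_contra hinf
      obtain ⟨W, hW, hcard⟩ := Set.Infinite.exists_subset_card_eq hinf E.card
      have := card_zeros_expSum_lt E a hE W fun z hz => hW hz
      omega
    refine ⟨hfin.toFinset, (card_zeros_expSum_lt E a hE _ fun z hz => by simpa using hz).le,
      fun x y hx hxy hz => ?_⟩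
    have hne : ∀ z ∈ Set.Icc x y, f z ≠ 0 := fun z hzI h0 =>
      (hz z (by simpa using h0) hzI.1).not_ge hzI.2
    have hc : ContinuousOn f (Set.Icc x y) := by
      apply Continuous.continuousOn; fun_prop
    rw [ha x hx, ha y (hx.trans hxy)]
    change SignType.sign (f x) = SignType.sign (f y)
    rcases lt_or_gt_of_ne (hne x ⟨le_rfl, hxy.le⟩) with h1 | h1 <;>
      rcases lt_or_gt_of_ne (hne y ⟨hxy.le, le_rfl⟩) with h2 | h2
    · rw [sign_neg h1, sign_neg h2]
    · obtain ⟨z, hz, h0⟩ := intermediate_value_Icc hxy.le hc ⟨h1.le, h2.le⟩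
      exact absurd h0 (hne z hz)
    · obtain ⟨z, hz, h0⟩ := intermediate_value_Icc' hxy.le hc ⟨h2.le, h1.le⟩
      exact absurd h0 (hne z hz)
    · rw [sign_pos h1, sign_pos h2]
  · push Not at hE
    refine ⟨∅, by simp, fun x y hx hxy _ => ?_⟩
    rw [ha x hx, ha y (hx.trans hxy)]
    rw [Finset.sum_eq_zero fun l hl => by rw [hE l hl, zero_mul],
      Finset.sum_eq_zero fun l hl => by rw [hE l hl, zero_mul]]

end IsExpSum

/-- The frequencies of the `b`-th power of `x ↦ ∑ i, p i ^ x`. -/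
noncomputable def powerFreqs {c : ℕ} (p : Fin c → ℝ) (b : ℕ) : Finset ℝ :=
  (Fintype.piFinset fun _ : Fin c => Finset.range (b + 1)).image
    fun k => ∑ i, (k i : ℝ) * Real.log (p i)

theorem card_powerFreqs_le {c : ℕ} (p : Fin c → ℝ) (b : ℕ) :
    (powerFreqs p b).card ≤ (b + 1) ^ c := by
  refine Finset.card_image_le.trans ?_
  simp

/-- The multinomial theorem produces the exponents `k` with `∑ k i = b`, so each `k i ≤ b`; the
constant `1` has frequency `0`. -/
theorem isExpSum_one_sub_sum_rpow_pow {c : ℕ} (p : Fin c → ℝ) (hp : ∀ i, 0 ≤ p i) (b : ℕ) :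
    IsExpSum (powerFreqs p b) fun x => 1 - (∑ i, p i ^ x) ^ b := by
  classical
  refine IsExpSum.sub ?_ ?_
  · have h0 : (0 : ℝ) ∈ powerFreqs p b :=
      Finset.mem_image.2 ⟨fun _ => 0, by simp, by simp⟩
    simpa using IsExpSum.exp h0
  -- Vanishing `p i` must be left out: `0 ^ x = 0` for `x > 0`, whereas `Real.log 0 = 0` would make
  -- the exponential equal to `1`.
  · set s : Finset (Fin c) := Finset.univ.filter fun i => p i ≠ 0
    have key : IsExpSum (powerFreqs p b) fun x => ∑ k ∈ s.piAntidiag b,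
        (Nat.multinomial s k : ℝ) * Real.exp ((∑ i, (k i : ℝ) * Real.log (p i)) * x) := by
      refine IsExpSum.sum _ fun k hk => IsExpSum.const_mul _ (IsExpSum.exp ?_)
      rw [Finset.mem_piAntidiag] at hk
      refine Finset.mem_image.2 ⟨k, ?_, rfl⟩
      simp only [Fintype.mem_piFinset, Finset.mem_range, Nat.lt_succ_iff]
      intro i
      by_cases hi : i ∈ s
      · rw [← hk.1]; exact Finset.single_le_sum (fun _ _ => Nat.zero_le _) hi
      · by_contra hne
        exact hi (hk.2 i (by omega))
    obtain ⟨a, ha⟩ := key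
    refine ⟨a, fun x hx => ?_⟩
    rw [← ha x hx]
    have h1 : ∑ i, p i ^ x = ∑ i ∈ s, p i ^ x := by
      refine (Finset.sum_subset (Finset.subset_univ s) fun i _ hi => ?_).symm
      have : p i = 0 := by simpa [s] using hi
      rw [this, Real.zero_rpow hx.ne']
    beta_reduce
    rw [h1, Finset.sum_pow_eq_sum_piAntidiag]
    refine Finset.sum_congr rfl fun k hk => ?_
    rw [Finset.mem_piAntidiag] at hk
    congr 1
    have h2 : ∑ i, (k i : ℝ) * Real.log (p i) = ∑ i ∈ s, (k i : ℝ) * Real.log (p i) := by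
      refine (Finset.sum_subset (Finset.subset_univ s) fun i _ hi => ?_).symm
      have : p i = 0 := by simpa [s] using hi
      simp [this]
    rw [h2, Finset.sum_mul, Real.exp_sum]
    refine Finset.prod_congr rfl fun i hi => ?_
    have hpi : 0 < p i := lt_of_le_of_ne (hp i) (Ne.symm (by simpa [s] using hi))
    rw [Real.rpow_def_of_pos hpi, ← Real.exp_nat_mul]
    congr 1; ring

/-! ### Trees with nodes in `F`, and dependence of the learner on the pattern of the data. -/

namespace DecisionTree

variable {X : Type u} {c : ℕ}

/-- All internal nodes of the tree carry node functions from `F`. -/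
def NodesIn (F : Finset (X → Bool)) : DecisionTree X c → Prop
  | leaf _ => True
  | node f l r => f ∈ F ∧ l.NodesIn F ∧ r.NodesIn F

theorem NodesIn.replaceLeaf {F : Finset (X → Bool)} {S T : DecisionTree X c} (hS : S.NodesIn F)
    (hT : T.NodesIn F) (p : List Bool) : (replaceLeaf S T p).NodesIn F := by
  induction T generalizing p with
  | leaf w => cases p <;> simp_all [DecisionTree.replaceLeaf, NodesIn]
  | node g l r ihl ihr =>
    obtain ⟨hg, hl, hr⟩ := hT
    rcases p with _ | ⟨_ | _, p⟩
    · exact ⟨hg, hl, hr⟩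
    · exact ⟨hg, ihl hl p, hr⟩
    · exact ⟨hg, hl, ihr hr p⟩

theorem NodesIn.leafOf_eq {F : Finset (X → Bool)} {T : DecisionTree X c} (hT : T.NodesIn F)
    {x x' : X} (h : ∀ f ∈ F, f x = f x') : T.leafOf x = T.leafOf x' := by
  induction T with
  | leaf w => rfl
  | node g l r ihl ihr =>
    obtain ⟨hg, hl, hr⟩ := hT
    simp only [leafOf, h g hg, ihl hl, ihr hr]

theorem NodesIn.predict_eq {F : Finset (X → Bool)} {T : DecisionTree X c} (hT : T.NodesIn F)
    {x x' : X} (h : ∀ f ∈ F, f x = f x') : T.predict x = T.predict x' := by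
  induction T with
  | leaf w => rfl
  | node g l r ihl ihr =>
    obtain ⟨hg, hl, hr⟩ := hT
    simp only [predict, h g hg, ihl hl, ihr hr]

theorem card_leaves_le (T : DecisionTree X c) : T.leaves.card ≤ T.internalNodes + 1 := by
  induction T with
  | leaf w => simp [leaves, internalNodes]
  | node g l r ihl ihr =>
    simp only [leaves, internalNodes]
    have h1 := Finset.card_union_le (l.leaves.image (List.cons false))
      (r.leaves.image (List.cons true))
    have h2 := Finset.card_image_le (s := l.leaves) (f := List.cons false)
    have h3 := Finset.card_image_le (s := r.leaves) (f := List.cons true)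
    omega

end DecisionTree

namespace TopDown

variable {X : Type u} {c n : ℕ}

open DecisionTree

/-- The datasets have the same labels, and no node function in `F` distinguishes their
examples. -/
def SamePattern (F : Finset (X → Bool)) (D D' : Dataset X c n) : Prop :=
  D.2 = D'.2 ∧ ∀ i, ∀ f ∈ F, f (D.1 i) = f (D'.1 i)

section SamePattern

variable {F : Finset (X → Bool)} {D D' : Dataset X c n}

theorem SamePattern.labelCount_eq (h : SamePattern F D D') (I : Finset (Fin n)) :
    labelCount D I = labelCount D' I := by
  funext y; simp only [labelCount, h.1]

theorem SamePattern.majorityLabel_eq (h : SamePattern F D D') (tb : TieBreaking X c)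
    (I : Finset (Fin n)) : majorityLabel tb D I = majorityLabel tb D' I := by
  simp only [majorityLabel, h.labelCount_eq]

theorem SamePattern.dataAt_eq (h : SamePattern F D D') {T : DecisionTree X c} (hT : T.NodesIn F)
    (l : List Bool) : dataAt D T l = dataAt D' T l := by
  simp only [dataAt, hT.leafOf_eq (h.2 _)]

theorem SamePattern.splittingFunction_eq (h : SamePattern F D D') {T : DecisionTree X c}
    (hT : T.NodesIn F) (g : (Fin c → ℝ) → ℝ) :
    splittingFunction g D T = splittingFunction g D' T := by
  have h1 : ∀ l, labelFraction D T l = labelFraction D' T l := by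
    intro l; funext y
    simp only [labelFraction, weight, h.dataAt_eq hT, h.labelCount_eq]
  simp only [splittingFunction, weight, h.dataAt_eq hT, h1]

theorem SamePattern.splitLeaf_eq (h : SamePattern F D D') {T : DecisionTree X c}
    (hT : T.NodesIn F) (tb : TieBreaking X c) (l : List Bool) {f : X → Bool} (hf : f ∈ F) :
    splitLeaf tb D T l f = splitLeaf tb D' T l f := by
  simp only [splitLeaf, h.dataAt_eq hT, h.majorityLabel_eq, h.2 _ f hf]

theorem nodesIn_splitLeaf {T : DecisionTree X c} (hT : T.NodesIn F) (tb : TieBreaking X c)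
    (D : Dataset X c n) (l : List Bool) {f : X → Bool} (hf : f ∈ F) :
    (splitLeaf tb D T l f).NodesIn F := by
  unfold splitLeaf
  refine NodesIn.replaceLeaf ?_ hT l
  exact ⟨hf, trivial, trivial⟩

theorem chooseSplit_mem_product (tb : TieBreaking X c) (hF : F.Nonempty) (g : (Fin c → ℝ) → ℝ)
    (D : Dataset X c n) (T : DecisionTree X c) :
    tb.chooseSplit T (bestSplits tb F g D T) ∈ T.leaves ×ˢ F :=
  (Finset.mem_filter.1 (tb.chooseSplit_mem T _ (bestSplits_nonempty tb F hF g D T))).1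

theorem nodesIn_learn (tb : TieBreaking X c) (hF : F.Nonempty) (g : (Fin c → ℝ) → ℝ)
    (D : Dataset X c n) (k : ℕ) : (learn tb F g D k).NodesIn F := by
  induction k with
  | zero => trivial
  | succ k ih =>
    exact nodesIn_splitLeaf ih tb D _
      (Finset.mem_product.1 (chooseSplit_mem_product tb hF g D (learn tb F g D k))).2

theorem SamePattern.bestSplits_eq (h : SamePattern F D D') {T : DecisionTree X c}
    (hT : T.NodesIn F) (tb : TieBreaking X c) (g : (Fin c → ℝ) → ℝ) :
    bestSplits tb F g D T = bestSplits tb F g D' T := by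
  have key : ∀ p ∈ T.leaves ×ˢ F, splittingFunction g D (splitLeaf tb D T p.1 p.2) =
      splittingFunction g D' (splitLeaf tb D' T p.1 p.2) := by
    intro p hp
    have hf := (Finset.mem_product.1 hp).2
    rw [← h.splitLeaf_eq hT tb p.1 hf,
      h.splittingFunction_eq (nodesIn_splitLeaf hT tb D p.1 hf) g]
  unfold bestSplits
  refine Finset.filter_congr fun p hp => forall₂_congr fun q hq => ?_
  rw [key p hp, key q hq]

/-- Tie-breaking sees only the current tree and the sets of optimal splits or labels, and all of
these are determined by the pattern. -/
theorem SamePattern.learn_eq (h : SamePattern F D D') (hF : F.Nonempty) (tb : TieBreaking X c)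
    (g : (Fin c → ℝ) → ℝ) (k : ℕ) : learn tb F g D k = learn tb F g D' k := by
  induction k with
  | zero => simp only [learn, h.majorityLabel_eq]
  | succ k ih =>
    have hT := nodesIn_learn tb hF g D' k
    simp only [learn, ih, h.bestSplits_eq hT]
    exact h.splitLeaf_eq hT tb _ (Finset.mem_product.1
      (chooseSplit_mem_product tb hF g D' (learn tb F g D' k))).2

theorem SamePattern.zeroOneLoss_eq (h : SamePattern F D D') {T : DecisionTree X c}
    (hT : T.NodesIn F) : zeroOneLoss T D = zeroOneLoss T D' := by
  simp only [zeroOneLoss, h.1, hT.predict_eq (h.2 _)]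

end SamePattern

/-! ### Breakpoints of the learned tree as a function of `α`. -/

/-- Two criteria that order the same trees in the same way at every reachable tree lead to the
same sequence of trees. -/
theorem bestSplits_congr (tb : TieBreaking X c) (F : Finset (X → Bool)) {g g' : (Fin c → ℝ) → ℝ}
    (D : Dataset X c n) (T : DecisionTree X c)
    (h : ∀ p ∈ T.leaves ×ˢ F, ∀ q ∈ T.leaves ×ˢ F,
      (splittingFunction g D (splitLeaf tb D T p.1 p.2) ≤
        splittingFunction g D (splitLeaf tb D T q.1 q.2) ↔
      splittingFunction g' D (splitLeaf tb D T p.1 p.2) ≤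
        splittingFunction g' D (splitLeaf tb D T q.1 q.2))) :
    bestSplits tb F g D T = bestSplits tb F g' D T := by
  unfold bestSplits
  exact Finset.filter_congr fun p hp => forall₂_congr fun q hq => h p hp q hq

open Classical in
/-- The trees that arise from the one-leaf tree by `k` splits with node functions from `F`. -/
noncomputable def reachable (tb : TieBreaking X c) (F : Finset (X → Bool)) (D : Dataset X c n) :
    ℕ → Finset (DecisionTree X c)
  | 0 => {.leaf (majorityLabel tb D Finset.univ)}
  | k + 1 => (reachable tb F D k).biUnion fun T =>
      (T.leaves ×ˢ F).image fun p => splitLeaf tb D T p.1 p.2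

theorem internalNodes_of_mem_reachable (tb : TieBreaking X c) (F : Finset (X → Bool))
    (D : Dataset X c n) (k : ℕ) {T : DecisionTree X c} (hT : T ∈ reachable tb F D k) :
    T.internalNodes = k := by
  induction k generalizing T with
  | zero =>
    simp only [reachable, Finset.mem_singleton] at hT
    subst hT; rfl
  | succ k ih =>
    simp only [reachable, Finset.mem_biUnion, Finset.mem_image] at hT
    obtain ⟨T', hT', p, hp, rfl⟩ := hT
    rw [splitLeaf, internalNodes_replaceLeaf _ _ _ _ _ (Finset.mem_product.1 hp).1, ih hT']

/-- The set `reachable` does not involve the criterion, so breakpoints can be collected over it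
before `α` is fixed. -/
theorem learn_mem_reachable (tb : TieBreaking X c) {F : Finset (X → Bool)} (hF : F.Nonempty)
    (g : (Fin c → ℝ) → ℝ) (D : Dataset X c n) (k : ℕ) :
    learn tb F g D k ∈ reachable tb F D k := by
  induction k with
  | zero => simp [learn, reachable]
  | succ k ih =>
    simp only [reachable, Finset.mem_biUnion, Finset.mem_image]
    exact ⟨_, ih, _, chooseSplit_mem_product tb hF g D _, rfl⟩

theorem card_splits_le (tb : TieBreaking X c) (F : Finset (X → Bool))
    (D : Dataset X c n) {k m : ℕ} (hk : k + 1 ≤ m) {T : DecisionTree X c}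
    (hT : T ∈ reachable tb F D k) : (T.leaves ×ˢ F).card ≤ m * F.card := by
  rw [Finset.card_product]
  have h1 := T.card_leaves_le
  rw [internalNodes_of_mem_reachable tb F D k hT] at h1
  exact Nat.mul_le_mul_right _ (h1.trans hk)

theorem card_reachable_le (tb : TieBreaking X c) (F : Finset (X → Bool))
    (D : Dataset X c n) {k m : ℕ} (hk : k ≤ m) :
    (reachable tb F D k).card ≤ (m * F.card) ^ k := by
  classical
  induction k with
  | zero => simp [reachable]
  | succ k ih =>
    rw [reachable, pow_succ]
    exact (Finset.card_biUnion_le_card_mul _ _ (m * F.card) fun T hT =>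
      Finset.card_image_le.trans (card_splits_le tb F D hk hT)).trans
      (Nat.mul_le_mul_right _ (ih (by omega)))

/-- The frequencies of the splitting function of `T`, up to the factor `C / (α - 1)`. -/
noncomputable def treeFreqs (D : Dataset X c n) (b : ℕ) (T : DecisionTree X c) : Finset ℝ :=
  T.leaves.biUnion fun l => powerFreqs (labelFraction D T l) b

theorem card_treeFreqs_le (D : Dataset X c n) (b : ℕ) (T : DecisionTree X c) :
    (treeFreqs D b T).card ≤ (T.internalNodes + 1) * (b + 1) ^ c :=
  (Finset.card_biUnion_le_card_mul _ _ _ fun _ _ => card_powerFreqs_le _ _).trans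
    (Nat.mul_le_mul_right _ T.card_leaves_le)

theorem isExpSum_splittingFunction (D : Dataset X c n) (b : ℕ) (T : DecisionTree X c) :
    IsExpSum (treeFreqs D b T)
      fun x => splittingFunction (fun p => 1 - (∑ i, p i ^ x) ^ b) D T := by
  refine IsExpSum.sum _ fun l hl => IsExpSum.const_mul _ ?_
  refine (isExpSum_one_sub_sum_rpow_pow _ (fun i => ?_) b).mono
    (Finset.subset_biUnion_of_mem (fun l => powerFreqs (labelFraction D T l) b) hl)
  unfold labelFraction; positivity

theorem splittingFunction_tsallisEntropy {C x : ℝ} (hx : x ≠ 1) (b : ℕ) (D : Dataset X c n)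
    (T : DecisionTree X c) : splittingFunction (tsallisEntropy C x b) D T =
      C / (x - 1) * splittingFunction (fun p => 1 - (∑ i, p i ^ x) ^ b) D T := by
  simp only [splittingFunction, tsallisEntropy, if_neg hx, Finset.mul_sum]
  exact Finset.sum_congr rfl fun l _ => by ring

/-- The factor `C / (α - 1)` has constant sign on each side of `1`. Hence it preserves, or reverses,
the order at both parameters alike, whatever the positive constants are. -/
theorem splittingFunction_tsallisEntropy_le_iff {C C' x y : ℝ} (hC : 0 < C) (hC' : 0 < C')
    (b : ℕ) (D : Dataset X c n) (T T' : DecisionTree X c) (hxy : x < 1 ∧ y < 1 ∨ 1 < x ∧ 1 < y)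
    (h : SignType.sign (splittingFunction (fun p => 1 - (∑ i, p i ^ x) ^ b) D T -
        splittingFunction (fun p => 1 - (∑ i, p i ^ x) ^ b) D T') =
      SignType.sign (splittingFunction (fun p => 1 - (∑ i, p i ^ y) ^ b) D T -
        splittingFunction (fun p => 1 - (∑ i, p i ^ y) ^ b) D T')) :
    splittingFunction (tsallisEntropy C x b) D T ≤ splittingFunction (tsallisEntropy C x b) D T' ↔
    splittingFunction (tsallisEntropy C' y b) D T ≤
      splittingFunction (tsallisEntropy C' y b) D T' := by
  rcases hxy with ⟨hx, hy⟩ | ⟨hx, hy⟩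
  · rw [splittingFunction_tsallisEntropy hx.ne, splittingFunction_tsallisEntropy hx.ne,
      splittingFunction_tsallisEntropy hy.ne, splittingFunction_tsallisEntropy hy.ne,
      mul_le_mul_left_of_neg (div_neg_of_pos_of_neg hC (sub_neg.2 hx)),
      mul_le_mul_left_of_neg (div_neg_of_pos_of_neg hC' (sub_neg.2 hy)),
      ← sub_nonneg, ← sub_nonneg (a := splittingFunction (fun p => 1 - (∑ i, p i ^ y) ^ b) D T),
      ← sign_nonneg_iff, h, sign_nonneg_iff]
  · rw [splittingFunction_tsallisEntropy hx.ne', splittingFunction_tsallisEntropy hx.ne',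
      splittingFunction_tsallisEntropy hy.ne', splittingFunction_tsallisEntropy hy.ne',
      mul_le_mul_iff_right₀ (div_pos hC (sub_pos.2 hx)),
      mul_le_mul_iff_right₀ (div_pos hC' (sub_pos.2 hy)),
      ← sub_nonpos, ← sub_nonpos (a := splittingFunction (fun p => 1 - (∑ i, p i ^ y) ^ b) D T),
      ← sign_nonpos_iff, h, sign_nonpos_iff]

/-- A tree with at most `m` internal nodes has at most `m + 1` leaves, each contributing at most `(b
+ 1) ^ c` frequencies; the factor `2` accounts for the two trees. -/
theorem exists_breakpoints_comparison (D : Dataset X c n) (b m : ℕ) (T T' : DecisionTree X c)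
    (hT : T.internalNodes ≤ m) (hT' : T'.internalNodes ≤ m) :
    ∃ Z : Finset ℝ, Z.card ≤ 2 * (m + 1) * (b + 1) ^ c ∧
      ∀ x y, 0 < x → x < y → (x < 1 ∧ y < 1 ∨ 1 < x ∧ 1 < y) → (∀ z ∈ Z, x ≤ z → y < z) →
      ∀ C C' : ℝ, 0 < C → 0 < C' →
      (splittingFunction (tsallisEntropy C x b) D T ≤
          splittingFunction (tsallisEntropy C x b) D T' ↔
        splittingFunction (tsallisEntropy C' y b) D T ≤
          splittingFunction (tsallisEntropy C' y b) D T') := by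
  obtain ⟨Z, hZ, h⟩ := (((isExpSum_splittingFunction D b T).mono
    (Finset.subset_union_left (s₂ := treeFreqs D b T'))).sub
    ((isExpSum_splittingFunction D b T').mono Finset.subset_union_right)).exists_sign_eq
  refine ⟨Z, ?_, fun x y hx hxy h1 hz C C' hC hC' =>
    splittingFunction_tsallisEntropy_le_iff hC hC' b D T T' h1 (h x y hx hxy hz)⟩
  calc Z.card ≤ _ := hZ
    _ ≤ (treeFreqs D b T).card + (treeFreqs D b T').card := Finset.card_union_le _ _
    _ ≤ (m + 1) * (b + 1) ^ c + (m + 1) * (b + 1) ^ c := by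
        gcongr
        · exact (card_treeFreqs_le D b T).trans (by gcongr)
        · exact (card_treeFreqs_le D b T').trans (by gcongr)
    _ = _ := by ring

/-- For fixed data and `β`, the learned tree is piecewise constant in `α`, with a number of
breakpoints that does not depend on the number of examples. -/
theorem exists_breakpoints_learn (tb : TieBreaking X c) {F : Finset (X → Bool)} (hF : F.Nonempty)
    (D : Dataset X c n) (b : ℕ) {s m : ℕ} (hs : s ≤ m) :
    ∃ A : Finset ℝ,
      A.card ≤ m * ((m * F.card) ^ m *
        ((m * F.card) * (m * F.card) * (2 * (m + 1) * (b + 1) ^ c))) + 1 ∧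
      ∀ x y, 0 < x → x < y → (∀ a ∈ A, x ≤ a → y < a) → ∀ C C' : ℝ, 0 < C → 0 < C' →
        learn tb F (tsallisEntropy C x b) D s = learn tb F (tsallisEntropy C' y b) D s := by
  classical
  -- The conditions are placed behind `∃ Z`, with `∅` as default, so that the chosen `Z` does not
  -- depend on membership proofs.
  have hZ : ∀ (k : ℕ) (T : DecisionTree X c) (p q : List Bool × (X → Bool)), ∃ Z : Finset ℝ,
      k < s → T ∈ reachable tb F D k → p ∈ T.leaves ×ˢ F → q ∈ T.leaves ×ˢ F →
      (Z.card ≤ 2 * (m + 1) * (b + 1) ^ c ∧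
      ∀ x y, 0 < x → x < y → (x < 1 ∧ y < 1 ∨ 1 < x ∧ 1 < y) → (∀ z ∈ Z, x ≤ z → y < z) →
      ∀ C C' : ℝ, 0 < C → 0 < C' →
      (splittingFunction (tsallisEntropy C x b) D (splitLeaf tb D T p.1 p.2) ≤
          splittingFunction (tsallisEntropy C x b) D (splitLeaf tb D T q.1 q.2) ↔
        splittingFunction (tsallisEntropy C' y b) D (splitLeaf tb D T p.1 p.2) ≤
          splittingFunction (tsallisEntropy C' y b) D (splitLeaf tb D T q.1 q.2))) := by
    intro k T p q
    by_cases h : k < s ∧ T ∈ reachable tb F D k ∧ p ∈ T.leaves ×ˢ F ∧ q ∈ T.leaves ×ˢ F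
    · obtain ⟨hk, hT, hp, hq⟩ := h
      have hn : ∀ p ∈ T.leaves ×ˢ F, (splitLeaf tb D T p.1 p.2).internalNodes ≤ m := by
        intro p hp
        rw [splitLeaf, internalNodes_replaceLeaf _ _ _ _ _ (Finset.mem_product.1 hp).1,
          internalNodes_of_mem_reachable tb F D k hT]
        omega
      obtain ⟨Z, hZ⟩ := exists_breakpoints_comparison D b m _ _ (hn p hp) (hn q hq)
      exact ⟨Z, fun _ _ _ _ => hZ⟩
    · exact ⟨∅, fun h1 h2 h3 h4 => absurd ⟨h1, h2, h3, h4⟩ h⟩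
  choose Z hZ using hZ
  refine ⟨insert 1 ((Finset.range s).biUnion fun k => (reachable tb F D k).biUnion fun T =>
    ((T.leaves ×ˢ F) ×ˢ (T.leaves ×ˢ F)).biUnion fun r => Z k T r.1 r.2), ?_, ?_⟩
  · refine (Finset.card_insert_le _ _).trans (Nat.add_le_add_right ?_ 1)
    have hmF : ∀ k < s, (m * F.card) ^ k ≤ (m * F.card) ^ m := fun k hk =>
      Nat.pow_le_pow_right (Nat.mul_pos (by omega) hF.card_pos) (by omega)
    refine (Finset.card_biUnion_le_card_mul _ _ _ fun k hk => ?_).trans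
      (Nat.mul_le_mul_right _ ((Finset.card_range s).le.trans hs))
    have hk' := Finset.mem_range.1 hk
    refine (Finset.card_biUnion_le_card_mul _ _ _ fun T hT => ?_).trans
      (Nat.mul_le_mul_right _ ((card_reachable_le tb F D (by omega : k ≤ m)).trans (hmF k hk')))
    have hc := card_splits_le tb F D (by omega : k + 1 ≤ m) hT
    refine (Finset.card_biUnion_le_card_mul _ _ _ fun r hr => ?_).trans
      (Nat.mul_le_mul_right _ ((Finset.card_product _ _).le.trans (Nat.mul_le_mul hc hc)))
    exact (hZ k T r.1 r.2 hk' hT (Finset.mem_product.1 hr).1 (Finset.mem_product.1 hr).2).1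
  · intro x y hx hxy hA C C' hC hC'
    -- As `1` is a breakpoint, it does not lie in `[x, y]`; the separate formula at `α = 1` is never
    -- compared with another parameter.
    have h1 : x < 1 ∧ y < 1 ∨ 1 < x ∧ 1 < y := by
      have := hA 1 (Finset.mem_insert_self _ _)
      rcases le_or_gt x 1 with h | h
      · exact Or.inl ⟨hxy.trans (this h), this h⟩
      · exact Or.inr ⟨h, h.trans hxy⟩
    have key : ∀ k ≤ s, learn tb F (tsallisEntropy C x b) D k =
        learn tb F (tsallisEntropy C' y b) D k := by
      intro k
      induction k with
      | zero => intro _; rfl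
      | succ k ih =>
        intro hk
        have hT := learn_mem_reachable tb hF (tsallisEntropy C' y b) D k
        have hb := bestSplits_congr tb F (g := tsallisEntropy C x b)
          (g' := tsallisEntropy C' y b) D (learn tb F (tsallisEntropy C' y b) D k)
          fun p hp q hq => (hZ k _ p q (by omega) hT hp hq).2 x y hx hxy h1 (fun z hz =>
            hA z (Finset.mem_insert_of_mem (Finset.mem_biUnion.2 ⟨k, Finset.mem_range.2 (by omega),
              Finset.mem_biUnion.2 ⟨_, hT, Finset.mem_biUnion.2 ⟨(p, q),
                Finset.mem_product.2 ⟨hp, hq⟩, hz⟩⟩⟩))) C C' hC hC'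
        simp only [learn, ih (by omega), hb]
    exact key s le_rfl

end TopDown

/-! ### Tail bounds and brackets. -/

section Concentration

variable {Ω : Type*} [MeasurableSpace Ω] (μ : Measure Ω)

/-- The centered sum `∑ j, Y (S j) - N 𝔼 Y` over a sample `S` of size `N`. -/
noncomputable def centeredSum {N : ℕ} (Y : Ω → ℝ) (S : Fin N → Ω) : ℝ :=
  ∑ j, Y (S j) - N * ∫ ω, Y ω ∂μ

variable {μ}

theorem centeredSum_sub {N : ℕ} {Y Y' : Ω → ℝ} (hY : Integrable Y μ) (hY' : Integrable Y' μ)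
    (S : Fin N → Ω) :
    centeredSum μ (fun ω => Y ω - Y' ω) S = centeredSum μ Y S - centeredSum μ Y' S := by
  simp only [centeredSum, Finset.sum_sub_distrib, integral_sub hY hY']; ring

variable [IsProbabilityMeasure μ]

theorem integrable_of_abs_le_one {Y : Ω → ℝ} (hY : Measurable Y) (hb : ∀ ω, |Y ω| ≤ 1) :
    Integrable Y μ :=
  Integrable.of_bound hY.aestronglyMeasurable 1 (Filter.Eventually.of_forall hb)

/-- Uses `exp z ≤ 1 + z + z ^ 2` for `|z| ≤ 1`, and `Y ^ 2 ≤ |Y|`: the `L¹` norm takes the role of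
the variance. -/
theorem integral_exp_mul_le {Y : Ω → ℝ} (hY : Measurable Y) (hb : ∀ ω, |Y ω| ≤ 1) {r l : ℝ}
    (hr : ∫ ω, |Y ω| ∂μ ≤ r) (hl0 : 0 ≤ l) (hl1 : l ≤ 1) :
    ∫ ω, Real.exp (l * Y ω) ∂μ ≤ Real.exp (l * ∫ ω, Y ω ∂μ + l ^ 2 * r) := by
  have hi := integrable_of_abs_le_one (μ := μ) hY hb
  have hpt : ∀ ω, Real.exp (l * Y ω) ≤ 1 + l * Y ω + l ^ 2 * |Y ω| := by
    intro ω
    have h1 : |l * Y ω| ≤ 1 := by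
      rw [abs_mul, abs_of_nonneg hl0]
      exact mul_le_one₀ hl1 (abs_nonneg _) (hb ω)
    have h2 := (abs_le.1 (Real.abs_exp_sub_one_sub_id_le h1)).2
    have h3 : (l * Y ω) ^ 2 ≤ l ^ 2 * |Y ω| := by
      rw [mul_pow]
      refine mul_le_mul_of_nonneg_left ?_ (sq_nonneg l)
      rw [← sq_abs, sq]
      exact mul_le_of_le_one_left (abs_nonneg _) (hb ω)
    linarith
  calc ∫ ω, Real.exp (l * Y ω) ∂μ ≤ ∫ ω, (1 + l * Y ω + l ^ 2 * |Y ω|) ∂μ :=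
        integral_mono_of_nonneg (Filter.Eventually.of_forall fun ω => (Real.exp_pos _).le)
          (((integrable_const 1).add (hi.const_mul l)).add (hi.abs.const_mul _))
          (Filter.Eventually.of_forall hpt)
    _ = 1 + l * ∫ ω, Y ω ∂μ + l ^ 2 * ∫ ω, |Y ω| ∂μ := by
        have h1 : Integrable (fun ω => 1 + l * Y ω) μ := (integrable_const 1).add (hi.const_mul l)
        have h2 : Integrable (fun ω => l ^ 2 * |Y ω|) μ := hi.abs.const_mul _
        rw [integral_add h1 h2, integral_add (integrable_const 1) (hi.const_mul l),
          integral_const_mul, integral_const_mul]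
        simp
    _ ≤ l * ∫ ω, Y ω ∂μ + l ^ 2 * r + 1 := by
        have := mul_le_mul_of_nonneg_left hr (sq_nonneg l)
        linarith
    _ ≤ _ := Real.add_one_le_exp _

/-- Chernoff's bound with `l = u / (2 r)`, the minimizer of `l ^ 2 * r - l * u`; the hypothesis `u ≤
2 * r` keeps `l ≤ 1`. -/
theorem measureReal_centeredSum_ge_le {Y : Ω → ℝ} (hY : Measurable Y) (hb : ∀ ω, |Y ω| ≤ 1)
    {r u : ℝ} (hr : ∫ ω, |Y ω| ∂μ ≤ r) (hr0 : 0 < r) (hu : 0 ≤ u) (hur : u ≤ 2 * r) (N : ℕ) :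
    (Measure.pi fun _ : Fin N => μ).real {S | N * u ≤ centeredSum μ Y S} ≤
      Real.exp (-(N * u ^ 2 / (4 * r))) := by
  set l : ℝ := u / (2 * r) with hl
  have hl0 : 0 ≤ l := by positivity
  have hl1 : l ≤ 1 := by rw [hl, div_le_one (by positivity)]; exact hur
  have hprod : ∀ S : Fin N → Ω, Real.exp (l * ∑ j, Y (S j)) = ∏ j, Real.exp (l * Y (S j)) := by
    intro S; rw [Finset.mul_sum, Real.exp_sum]
  have hint : Integrable (fun S : Fin N → Ω => Real.exp (l * ∑ j, Y (S j)))
      (Measure.pi fun _ : Fin N => μ) := by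
    have hm : Measurable fun S : Fin N → Ω => Real.exp (l * ∑ j, Y (S j)) :=
      ((Finset.measurable_sum _ fun j _ => hY.comp (measurable_pi_apply j)).const_mul l).exp
    refine Integrable.of_bound hm.aestronglyMeasurable (Real.exp (l * N)) (Filter.Eventually.of_forall ?_)
    intro S
    rw [Real.norm_eq_abs, Real.abs_exp]
    refine Real.exp_le_exp.2 (mul_le_mul_of_nonneg_left ?_ hl0)
    calc ∑ j, Y (S j) ≤ ∑ _j : Fin N, (1 : ℝ) :=
          Finset.sum_le_sum fun j _ => (le_abs_self _).trans (hb _)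
      _ = N := by simp
  have h1 := ProbabilityTheory.measure_ge_le_exp_mul_mgf (μ := Measure.pi fun _ : Fin N => μ)
    (X := fun S => ∑ j, Y (S j)) (N * u + N * ∫ ω, Y ω ∂μ) hl0 hint
  have hset : {S : Fin N → Ω | N * u ≤ centeredSum μ Y S} =
      {S | N * u + N * ∫ ω, Y ω ∂μ ≤ ∑ j, Y (S j)} := by
    ext S; simp only [centeredSum, Set.mem_ofPred_eq, le_sub_iff_add_le]
  rw [hset]
  refine h1.trans ?_
  have hmgf : ProbabilityTheory.mgf (fun S : Fin N → Ω => ∑ j, Y (S j))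
      (Measure.pi fun _ : Fin N => μ) l ≤
      Real.exp (N * (l * ∫ ω, Y ω ∂μ + l ^ 2 * r)) := by
    rw [ProbabilityTheory.mgf]
    simp only [hprod]
    rw [integral_fintype_prod_eq_pow (fun ω => Real.exp (l * Y ω)), Fintype.card_fin,
      Real.exp_nat_mul]
    exact pow_le_pow_left₀ (integral_nonneg fun ω => (Real.exp_pos _).le)
      (integral_exp_mul_le hY hb hr hl0 hl1) N
  refine (mul_le_mul_of_nonneg_left hmgf (Real.exp_pos _).le).trans ?_
  rw [← Real.exp_add]
  refine Real.exp_le_exp.2 (le_of_eq ?_)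
  rw [hl]; field_simp; ring

theorem measureReal_abs_centeredSum_ge_le {Y : Ω → ℝ} (hY : Measurable Y) (hb : ∀ ω, |Y ω| ≤ 1)
    {r u : ℝ} (hr : ∫ ω, |Y ω| ∂μ ≤ r) (hr0 : 0 < r) (hu : 0 ≤ u) (hur : u ≤ 2 * r) (N : ℕ) :
    (Measure.pi fun _ : Fin N => μ).real {S | N * u ≤ |centeredSum μ Y S|} ≤
      2 * Real.exp (-(N * u ^ 2 / (4 * r))) := by
  have h1 := measureReal_centeredSum_ge_le hY hb hr hr0 hu hur N
  have h2 := measureReal_centeredSum_ge_le (μ := μ) (Y := fun ω => -Y ω) hY.neg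
    (fun ω => by rw [abs_neg]; exact hb ω) (by simpa only [abs_neg] using hr) hr0 hu hur N
  have hsub : {S : Fin N → Ω | N * u ≤ |centeredSum μ Y S|} ⊆
      {S | N * u ≤ centeredSum μ Y S} ∪ {S | N * u ≤ centeredSum μ (fun ω => -Y ω) S} := by
    intro S hS
    have hneg : centeredSum μ (fun ω => -Y ω) S = -centeredSum μ Y S := by
      simp only [centeredSum, integral_neg, Finset.sum_neg_distrib]; ring
    rw [Set.mem_union, Set.mem_ofPred_eq, Set.mem_ofPred_eq, hneg]
    exact le_abs.1 hS
  refine (measureReal_mono hsub).trans ((measureReal_union_le _ _).trans ?_)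
  linarith

theorem measureReal_biUnion_abs_centeredSum_ge_le {κ : Type*} (I : Finset κ) {Y : κ → Ω → ℝ}
    (hY : ∀ i ∈ I, Measurable (Y i)) (hb : ∀ i ∈ I, ∀ ω, |Y i ω| ≤ 1)
    {r u W : ℝ} (hr : ∀ i ∈ I, ∫ ω, |Y i ω| ∂μ ≤ r) (hr0 : 0 < r) (hu : 0 ≤ u)
    (hur : u ≤ 2 * r) (hW : (I.card : ℝ) ≤ W) (N : ℕ) :
    (Measure.pi fun _ : Fin N => μ).real (⋃ i ∈ I, {S | N * u ≤ |centeredSum μ (Y i) S|}) ≤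
      W * (2 * Real.exp (-(N * u ^ 2 / (4 * r)))) := by
  refine (measureReal_biUnion_finset_le I _).trans ?_
  refine (Finset.sum_le_sum fun i hi =>
    measureReal_abs_centeredSum_ge_le (hY i hi) (hb i hi) (hr i hi) hr0 hu hur N).trans ?_
  rw [Finset.sum_const, nsmul_eq_mul]
  exact mul_le_mul_of_nonneg_right hW (by positivity)

/-- A function dominated by the indicator of `E` has a small centered sum when the indicator
does. -/
theorem abs_centeredSum_le_of_indicator {N : ℕ} {Y : Ω → ℝ} {E : Set Ω} (hE : MeasurableSet E)
    (h : ∀ ω, |Y ω| ≤ E.indicator 1 ω) (S : Fin N → Ω) :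
    |centeredSum μ Y S| ≤ centeredSum μ (E.indicator 1) S + 2 * (N * μ.real E) := by
  have h1 : |∑ j, Y (S j)| ≤ ∑ j, E.indicator (1 : Ω → ℝ) (S j) :=
    (Finset.abs_sum_le_sum_abs _ _).trans (Finset.sum_le_sum fun j _ => h _)
  have h2 : |∫ ω, Y ω ∂μ| ≤ μ.real E := by
    rw [← integral_indicator_one hE]
    refine abs_integral_le_integral_abs.trans (integral_mono_of_nonneg
      (Filter.Eventually.of_forall fun ω => abs_nonneg _) ?_ (Filter.Eventually.of_forall h))
    exact (integrable_const (1 : ℝ)).indicator hE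
  have h3 : |centeredSum μ Y S| ≤ |∑ j, Y (S j)| + N * |∫ ω, Y ω ∂μ| := by
    unfold centeredSum
    refine (abs_sub _ _).trans ?_
    rw [abs_mul, Nat.abs_cast]
  have h4 := mul_le_mul_of_nonneg_left h2 (Nat.cast_nonneg (α := ℝ) N)
  have h5 : centeredSum μ (E.indicator 1) S =
    ∑ j, E.indicator (1 : Ω → ℝ) (S j) - N * μ.real E := by
    rw [centeredSum, integral_indicator_one hE]
  linarith

/-- A one-parameter family that is piecewise constant in the parameter, with at most `M`
breakpoints at every point of the probability space, has bracketing numbers `O(M / γ)`. -/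
theorem exists_brackets {φ : ℝ → Ω → ℝ} {A : Ω → Finset ℝ} {U : Finset ℝ} {M : ℕ}
    (hM : ∀ ω, (A ω).card ≤ M) (hU : ∀ ω, A ω ⊆ U) (hA : ∀ a, MeasurableSet {ω | a ∈ A ω})
    (hφ : ∀ ω x y, 0 < x → x < y → (∀ a ∈ A ω, x ≤ a → y < a) → φ x ω = φ y ω)
    {γ : ℝ} (hγ : 0 < γ) :
    ∃ (key : ℝ → ℕ) (e : ℕ → Set Ω), (∀ x, (key x : ℝ) ≤ 2 * M / γ) ∧
      (∀ k, MeasurableSet (e k)) ∧ (∀ k, μ.real (e k) ≤ γ) ∧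
      ∀ x y ω, 0 < x → 0 < y → key x = key y → ω ∉ e (key x) → φ x ω = φ y ω := by
  classical
  -- The sum of the masses `w a` is the expected number of breakpoints, hence at most `M`.
  set w : ℝ → ℝ := fun a => μ.real {ω | a ∈ A ω} with hw
  have hw0 : ∀ a, 0 ≤ w a := fun a => measureReal_nonneg
  have hwM : ∑ a ∈ U, w a ≤ M := by
    calc ∑ a ∈ U, w a = ∑ a ∈ U, ∫ ω, {ω | a ∈ A ω}.indicator (1 : Ω → ℝ) ω ∂μ :=
          Finset.sum_congr rfl fun a _ => (integral_indicator_one (hA a)).symm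
      _ = ∫ ω, ∑ a ∈ U, {ω | a ∈ A ω}.indicator (1 : Ω → ℝ) ω ∂μ :=
          (integral_finsetSum _ fun a _ => (integrable_const (1 : ℝ)).indicator (hA a)).symm
      _ ≤ ∫ _ω, (M : ℝ) ∂μ := by
          refine integral_mono_of_nonneg (Filter.Eventually.of_forall fun ω =>
            Finset.sum_nonneg fun a _ => Set.indicator_nonneg (fun _ _ => zero_le_one) _)
            (integrable_const _) (Filter.Eventually.of_forall fun ω => ?_)
          have : ∑ a ∈ U, {ω | a ∈ A ω}.indicator (1 : Ω → ℝ) ω = (A ω).card := by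
            simp only [Set.indicator_apply, Set.mem_ofPred_eq, Pi.one_apply]
            rw [Finset.sum_boole, Finset.filter_mem_eq_inter, Finset.inter_eq_right.2 (hU ω)]
          simp only [this]
          exact_mod_cast hM ω
      _ = M := by simp
  -- Each `a` is counted once when reached and once when passed. So `v` grows by at least `1` across
  -- any `[x, y]` with `x < y` that contains `a`, even as an endpoint; this deals with atoms and
  -- costs the factor `2` in `2 * M / γ`.
  set v : ℝ → ℝ → ℝ := fun x a => (if a ≤ x then 1 else 0) + (if a < x then 1 else 0) with hv
  set G : ℝ → ℝ := fun x => ∑ a ∈ U, w a * v x a with hG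
  have hG0 : ∀ x, 0 ≤ G x := fun x => Finset.sum_nonneg fun a _ =>
    mul_nonneg (hw0 a) (by simp only [hv]; split_ifs <;> norm_num)
  have hGM : ∀ x, G x ≤ 2 * M := fun x => by
    calc G x ≤ ∑ a ∈ U, w a * 2 := Finset.sum_le_sum fun a _ =>
          mul_le_mul_of_nonneg_left (by simp only [hv]; split_ifs <;> norm_num) (hw0 a)
      _ ≤ _ := by rw [← Finset.sum_mul]; linarith
  set key : ℝ → ℕ := fun x => ⌊G x / γ⌋₊ with hkey
  set H : ℕ → Finset ℝ := fun k =>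
    U.filter fun a => ∃ x y, x < y ∧ key x = k ∧ key y = k ∧ x ≤ a ∧ a ≤ y with hH
  refine ⟨key, fun k => ⋃ a ∈ H k, {ω | a ∈ A ω}, fun x => ?_, fun k => ?_, fun k => ?_, ?_⟩
  · exact (Nat.floor_le (div_nonneg (hG0 x) hγ.le)).trans
      (div_le_div_of_nonneg_right (hGM x) hγ.le)
  · exact Finset.measurableSet_biUnion _ fun a _ => hA a
  · refine (measureReal_biUnion_finset_le _ _).trans ?_
    change ∑ a ∈ H k, w a ≤ γ
    rcases (H k).eq_empty_or_nonempty with h0 | h0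
    · rw [h0, Finset.sum_empty]; exact hγ.le
    have hex : ∀ a, ∃ x y, a ∈ H k → x < y ∧ key x = k ∧ key y = k ∧ x ≤ a ∧ a ≤ y := by
      intro a
      by_cases ha : a ∈ H k
      · obtain ⟨x, y, h⟩ := (Finset.mem_filter.1 ha).2
        exact ⟨x, y, fun _ => h⟩
      · exact ⟨0, 0, fun h => absurd h ha⟩
    choose p q hpq using hex
    -- The leftmost left end and the rightmost right end both have key `k`, so `G` rises by at most
    -- `γ` between them, while each `a ∈ H k` lies between them and contributes at least `w a` to
    -- the rise.
    obtain ⟨a₀, ha₀, hmin⟩ := Finset.exists_min_image (H k) p h0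
    obtain ⟨a₁, ha₁, hmax⟩ := Finset.exists_max_image (H k) q h0
    have hlt : p a₀ < q a₁ := (hpq a₀ ha₀).1.trans_le (hmax a₀ ha₀)
    have hGd : G (q a₁) - G (p a₀) ≤ γ := by
      have h1 : (k : ℝ) ≤ G (p a₀) / γ := by
        rw [← (hpq a₀ ha₀).2.1]
        exact Nat.floor_le (div_nonneg (hG0 _) hγ.le)
      have h2 : G (q a₁) / γ < k + 1 := by
        rw [← (hpq a₁ ha₁).2.2.1]
        exact Nat.lt_floor_add_one _
      rw [le_div_iff₀ hγ] at h1
      rw [div_lt_iff₀ hγ] at h2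
      linarith
    refine le_trans ?_ hGd
    simp only [hG, ← Finset.sum_sub_distrib, ← mul_sub]
    have hmono : ∀ a, 0 ≤ v (q a₁) a - v (p a₀) a := by
      intro a
      simp only [hv]
      split_ifs <;> first | (exfalso; linarith) | norm_num
    calc ∑ a ∈ H k, w a ≤ ∑ a ∈ H k, w a * (v (q a₁) a - v (p a₀) a) := by
          refine Finset.sum_le_sum fun a ha => le_mul_of_one_le_right (hw0 a) ?_
          have h1 : p a₀ ≤ a := (hmin a ha).trans (hpq a ha).2.2.2.1
          have h2 : a ≤ q a₁ := (hpq a ha).2.2.2.2.trans (hmax a ha)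
          simp only [hv]
          split_ifs <;> first | (exfalso; linarith) | norm_num
      _ ≤ _ := Finset.sum_le_sum_of_subset_of_nonneg (Finset.filter_subset _ _)
          fun a _ _ => mul_nonneg (hw0 a) (hmono a)
  · have main : ∀ x y ω, 0 < x → x < y → key x = key y →
        ω ∉ ⋃ a ∈ H (key x), {ω | a ∈ A ω} → φ x ω = φ y ω := by
      intro x y ω hx hxy hk hω
      refine hφ ω x y hx hxy fun a ha hxa => ?_
      by_contra! hay
      exact hω (Set.mem_biUnion (x := a) (Finset.mem_coe.2 (Finset.mem_filter.2
        ⟨hU ω ha, x, y, hxy, rfl, hk.symm, hxa, hay⟩)) ha)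
    intro x y ω hx hy hk hω
    rcases lt_trichotomy x y with h | h | h
    · exact main x y ω hx h hk hω
    · rw [h]
    · exact (main y x ω hy h hk.symm (by rwa [← hk])).symm

end Concentration

/-! ### Chaining with brackets. -/

section Chaining

variable {Ω : Type*} [MeasurableSpace Ω] {μ : Measure Ω} [IsProbabilityMeasure μ]

/-- Level `J` ends the chain: its brackets have mass at most `ε / 16`, yet the scale is still coarse
enough for the condition `u ≤ 2 * r` of the tail bound. -/
theorem exists_half_pow_near {ε : ℝ} (hε : 0 < ε) (hε1 : ε ≤ 1) :
    ∃ J : ℕ, (1 / 2 : ℝ) ^ J ≤ ε / 16 ∧ ε ≤ 32 * (1 / 2 : ℝ) ^ J := by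
  obtain ⟨k, hk1, hk2⟩ := exists_nat_pow_near_of_lt_one (x := ε / 16) (y := (1 / 2 : ℝ))
    (by positivity) (by linarith) (by norm_num) (by norm_num)
  refine ⟨k + 1, hk1.le, ?_⟩
  rw [pow_succ]; linarith

theorem one_add_div_eight_le_pow (j : ℕ) : 1 + (j : ℝ) / 8 ≤ (9 / 8 : ℝ) ^ j := by
  have := one_add_mul_le_pow (a := (1 / 8 : ℝ)) (by norm_num) j
  norm_num at this ⊢
  linarith

/-- The tail bound at one level of the chaining argument. -/
theorem chaining_level_bound {V δ a q : ℝ} (hV : 2 ≤ V) (hδ : 0 < δ) (hδ1 : δ ≤ 1) (j : ℕ)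
    (ha : 300 * (Real.log V + Real.log (1 / δ)) ≤ a) (hq : 1 + (j : ℝ) / 8 ≤ q) :
    V ^ 2 * 4 ^ j * (2 * Real.exp (-(a * q))) ≤ δ / 4 * (1 / 2) ^ j := by
  have hlV : Real.log 2 ≤ Real.log V := Real.log_le_log (by norm_num) hV
  have hl2 : 0 < Real.log 2 := Real.log_pos (by norm_num)
  have hld : 0 ≤ Real.log (1 / δ) := Real.log_nonneg (by rw [le_div_iff₀ hδ]; linarith)
  have hld' : Real.log (1 / δ) = -Real.log δ := by rw [one_div, Real.log_inv]
  have hL : V ^ 2 * 4 ^ j * (2 * Real.exp (-(a * q))) =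
      Real.exp (2 * Real.log V + 2 * j * Real.log 2 + Real.log 2 - a * q) := by
    have h4 : (4 : ℝ) ^ j = Real.exp (2 * j * Real.log 2) := by
      rw [mul_comm 2 (j : ℝ), mul_assoc, Real.exp_nat_mul, two_mul, Real.exp_add,
        Real.exp_log (by norm_num)]
      norm_num
    have hV2 : V ^ 2 = Real.exp (2 * Real.log V) := by
      rw [two_mul, Real.exp_add, Real.exp_log (by linarith), sq]
    rw [h4, hV2, sub_eq_add_neg, Real.exp_add, Real.exp_add, Real.exp_add,
      Real.exp_log (by norm_num : (0 : ℝ) < 2)]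
    ring
  have hR : δ / 4 * (1 / 2) ^ j = Real.exp (Real.log δ - 2 * Real.log 2 - j * Real.log 2) := by
    rw [Real.exp_sub, Real.exp_sub, two_mul, Real.exp_add, Real.exp_nat_mul, Real.exp_log hδ,
      Real.exp_log (by norm_num : (0 : ℝ) < 2), one_div, inv_pow]
    ring
  rw [hL, hR]
  refine Real.exp_le_exp.2 ?_
  -- It suffices that `a * q` is at least `2 log V + log (1 / δ) + 3 (j + 1) log 2`; the constant
  -- `300` is generous, as `log V ≥ log 2`.
  have ha0 : 0 ≤ a := le_trans (by linarith [hlV, hl2]) ha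
  have h1 : a * (1 + (j : ℝ) / 8) ≤ a * q := mul_le_mul_of_nonneg_left hq ha0
  have hj : (0 : ℝ) ≤ j := Nat.cast_nonneg j
  have h2 : 300 * Real.log 2 * j ≤ a * j :=
    mul_le_mul_of_nonneg_right (by linarith) hj
  have h3 : 0 ≤ Real.log 2 * j := by positivity
  nlinarith

/-- Uniform deviation bound by chaining with brackets: when the bracketing numbers of a class of
`[0, 1]`-valued functions are at most `V / γ`, a sample of size of order
`(log V + log (1 / δ)) / ε ^ 2` suffices, with no logarithmic factor in `1 / ε`. -/
theorem exists_bad_of_brackets {Θ ι : Type*} {φ : Θ → Ω → ℝ} (hφm : ∀ θ, Measurable (φ θ))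
    (hφ0 : ∀ θ ω, 0 ≤ φ θ ω) (hφ1 : ∀ θ ω, φ θ ω ≤ 1) {V : ℝ} (hV : 2 ≤ V)
    (hbr : ∀ γ : ℝ, 0 < γ → γ ≤ 1 → ∃ (key : Θ → ι) (K : Finset ι) (e : ι → Set Ω),
      (∀ θ, key θ ∈ K) ∧ (K.card : ℝ) ≤ V / γ ∧ (∀ i, MeasurableSet (e i)) ∧
      (∀ i, μ.real (e i) ≤ γ) ∧
      ∀ θ θ' ω, key θ = key θ' → ω ∉ e (key θ) → φ θ ω = φ θ' ω)
    {ε δ : ℝ} (hε : 0 < ε) (hε1 : ε ≤ 1) (hδ : 0 < δ) (hδ1 : δ ≤ 1) {N : ℕ}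
    (hN : 1000000 * (Real.log V + Real.log (1 / δ)) ≤ N * ε ^ 2) :
    ∃ bad : Set (Fin N → Ω), (Measure.pi fun _ : Fin N => μ).real bad ≤ δ ∧
      ∀ S, S ∉ bad → ∀ θ, |centeredSum μ (φ θ) S| ≤ N * (ε / 2) := by
  classical
  rcases isEmpty_or_nonempty Θ with hΘ | hΘ
  · exact ⟨∅, by simpa using hδ.le, fun S _ θ => isEmptyElim θ⟩
  obtain ⟨J, hJ1, hJ2⟩ := exists_half_pow_near hε hε1
  choose key K e hkey hcard hem heμ hφe using fun j : ℕ =>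
    hbr ((1 / 2) ^ j) (by positivity) (pow_le_one₀ (by norm_num) (by norm_num))
  set rep : ℕ → ι → Θ := fun j => Function.invFun (key j) with hrep
  have hrepkey : ∀ j θ, key j (rep j (key j θ)) = key j θ := fun j θ =>
    Function.invFun_eq ⟨θ, rfl⟩
  have hcard' : ∀ j, ((K j).card : ℝ) ≤ V * 2 ^ j := fun j => by
    refine (hcard j).trans (le_of_eq ?_)
    rw [one_div, inv_pow, div_inv_eq_mul]
  -- The budgets `u j` sum to at most `ε / 4`, yet decay slowly enough that `u j ^ 2 / r j` grows
  -- like `(9 / 8) ^ j` and beats the `4 ^ j` links. The value `r j` is the total mass `2 ^ (-j) + 2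
  -- ^ (-(j - 1))` of two adjacent brackets.
  set u : ℕ → ℝ := fun j => ε / 16 * (3 / 4) ^ j with hu
  set r : ℕ → ℝ := fun j => 3 * (1 / 2) ^ j with hr
  have hu0 : ∀ j, 0 ≤ u j := fun j => by positivity
  have hr0 : ∀ j, 0 < r j := fun j => by positivity
  have hur : ∀ j ≤ J, u j ≤ 2 * r j := by
    intro j hj
    have h1 : (1 / 2 : ℝ) ^ J ≤ (1 / 2) ^ j :=
      pow_le_pow_of_le_one (by norm_num) (by norm_num) hj
    have h2 : (3 / 4 : ℝ) ^ j ≤ 1 := pow_le_one₀ (by norm_num) (by norm_num)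
    have h3 : u j ≤ ε / 16 * 1 := mul_le_mul_of_nonneg_left h2 (by positivity)
    have h4 : (0 : ℝ) ≤ (1 / 2) ^ j := by positivity
    simp only [hr]
    linarith
  -- Here `3072 = 16 ^ 2 * 4 * 3`, and `1000000 / 3072 ≥ 300` as `chaining_level_bound` requires.
  have hexp : ∀ j, (N : ℝ) * u j ^ 2 / (4 * r j) = N * ε ^ 2 / 3072 * (9 / 8) ^ j := by
    intro j
    have h2 : (9 / 8 : ℝ) ^ j * (1 / 2) ^ j = ((3 / 4) ^ j) ^ 2 := by
      rw [← mul_pow, ← pow_mul, mul_comm j 2, pow_mul]; norm_num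
    have h3 : (0 : ℝ) < (1 / 2) ^ j := by positivity
    simp only [hu, hr]
    rw [div_eq_iff (by positivity), mul_pow, ← h2]
    ring
  have hlevel : ∀ j, V ^ 2 * 4 ^ j * (2 * Real.exp (-(N * u j ^ 2 / (4 * r j)))) ≤
      δ / 4 * (1 / 2) ^ j := by
    intro j
    rw [hexp]
    have hlV : 0 ≤ Real.log V := Real.log_nonneg (by linarith)
    have hld : 0 ≤ Real.log (1 / δ) := Real.log_nonneg (by rw [le_div_iff₀ hδ]; linarith)
    exact chaining_level_bound hV hδ hδ1 j (by linarith) (one_add_div_eight_le_pow j)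
  have hφi : ∀ θ, Integrable (φ θ) μ := fun θ =>
    integrable_of_abs_le_one (hφm θ) fun ω => abs_le.2 ⟨by linarith [hφ0 θ ω], hφ1 θ ω⟩
  -- bad events: at the first level, at the links between levels, at the last bracket
  set B₀ : Set (Fin N → Ω) :=
    ⋃ i ∈ K 0, {S | N * u 0 ≤ |centeredSum μ (φ (rep 0 i)) S|} with hB₀
  set Y : ℕ → ι × ι → Ω → ℝ :=
    fun j p ω => φ (rep (j + 1) p.1) ω - φ (rep j p.2) ω with hY
  have hφd : ∀ θ θ' ω, |φ θ ω - φ θ' ω| ≤ 1 := fun θ θ' ω => abs_le.2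
    ⟨by linarith [hφ0 θ ω, hφ1 θ' ω], by linarith [hφ0 θ' ω, hφ1 θ ω]⟩
  have hY1 : ∀ j p ω, |Y j p ω| ≤ 1 := fun j p ω => hφd _ _ ω
  -- Filtering by the `L¹` norm keeps every link that comes from a single `θ`, since its two
  -- functions agree with `φ θ` outside two brackets.
  set I : ℕ → Finset (ι × ι) :=
    fun j => (K (j + 1) ×ˢ K j).filter fun p => ∫ ω, |Y j p ω| ∂μ ≤ r (j + 1) with hI
  set B₁ : ℕ → Set (Fin N → Ω) :=
    fun j => ⋃ p ∈ I j, {S | N * u (j + 1) ≤ |centeredSum μ (Y j p) S|} with hB₁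
  set B₂ : Set (Fin N → Ω) :=
    ⋃ i ∈ K J, {S | N * u J ≤ |centeredSum μ ((e J i).indicator 1) S|} with hB₂
  have hP₀ : (Measure.pi fun _ : Fin N => μ).real B₀ ≤ δ / 4 * (1 / 2) ^ 0 := by
    refine (measureReal_biUnion_abs_centeredSum_ge_le (r := r 0) (W := V ^ 2 * 4 ^ 0) (K 0)
      (fun i _ => hφm _)
      (fun i _ ω => abs_le.2 ⟨by linarith [hφ0 (rep 0 i) ω], hφ1 _ ω⟩) (fun i _ => ?_) (hr0 0)
      (hu0 0) (hur 0 (Nat.zero_le _)) ?_ N).trans (hlevel 0)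
    · calc ∫ ω, |φ (rep 0 i) ω| ∂μ ≤ ∫ _ω, (1 : ℝ) ∂μ :=
            integral_mono (hφi _).abs (integrable_const _)
              fun ω => abs_le.2 ⟨by linarith [hφ0 (rep 0 i) ω], hφ1 _ ω⟩
        _ ≤ r 0 := by simp [hr]
    · refine (hcard' 0).trans ?_
      rw [pow_zero, pow_zero]
      nlinarith
  have hP₁ : ∀ j < J, (Measure.pi fun _ : Fin N => μ).real (B₁ j) ≤
      δ / 4 * (1 / 2) ^ (j + 1) := by
    intro j hj
    refine (measureReal_biUnion_abs_centeredSum_ge_le (r := r (j + 1))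
      (W := V ^ 2 * 4 ^ (j + 1)) (I j)
      (fun p _ => (hφm _).sub (hφm _)) (fun p _ => hY1 j p)
      (fun p hp => (Finset.mem_filter.1 hp).2) (hr0 _) (hu0 _) (hur _ hj) ?_ N).trans (hlevel _)
    · calc ((I j).card : ℝ) ≤ ((K (j + 1)).card * (K j).card : ℕ) := by
            rw [← Finset.card_product]
            exact_mod_cast Finset.card_filter_le _ _
        _ ≤ (V * 2 ^ (j + 1)) * (V * 2 ^ (j + 1)) := by
            push_cast
            refine mul_le_mul (hcard' _) ((hcard' j).trans ?_) (Nat.cast_nonneg _) (by positivity)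
            gcongr
            · norm_num
            · omega
        _ = V ^ 2 * 4 ^ (j + 1) := by
            rw [show (4 : ℝ) = 2 * 2 by norm_num, mul_pow]; ring
  have hP₂ : (Measure.pi fun _ : Fin N => μ).real B₂ ≤ δ / 4 := by
    refine (measureReal_biUnion_abs_centeredSum_ge_le (r := r J) (W := V ^ 2 * 4 ^ J) (K J)
      (Y := fun i => (e J i).indicator 1)
      (fun i _ => measurable_one.indicator (hem J i)) (fun i _ ω => ?_) (fun i _ => ?_) (hr0 J)
      (hu0 J) (hur J le_rfl) ?_ N).trans ((hlevel J).trans ?_)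
    · rw [Set.indicator_apply]; split_ifs <;> simp
    · have h1 : ∀ ω, |(e J i).indicator (1 : Ω → ℝ) ω| = (e J i).indicator (1 : Ω → ℝ) ω :=
        fun ω => abs_of_nonneg (Set.indicator_nonneg (fun _ _ => zero_le_one) ω)
      simp only [h1]
      rw [integral_indicator_one (hem J i)]
      refine (heμ J i).trans ?_
      have : (0 : ℝ) < (1 / 2) ^ J := by positivity
      simp only [hr]; linarith
    · refine (hcard' J).trans ?_
      have h2 : (2 : ℝ) ^ J ≤ 4 ^ J := by gcongr; norm_num
      have h3 : V ≤ V ^ 2 := by nlinarith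
      exact mul_le_mul h3 h2 (by positivity) (by positivity)
    · exact mul_le_of_le_one_right (by positivity) (pow_le_one₀ (by norm_num) (by norm_num))
  refine ⟨(B₀ ∪ ⋃ j ∈ Finset.range J, B₁ j) ∪ B₂, ?_, ?_⟩
  · refine (measureReal_union_le _ _).trans ?_
    have h1 := measureReal_union_le (μ := Measure.pi fun _ : Fin N => μ) B₀
      (⋃ j ∈ Finset.range J, B₁ j)
    have h2 : (Measure.pi fun _ : Fin N => μ).real (⋃ j ∈ Finset.range J, B₁ j) ≤
        ∑ j ∈ Finset.range J, δ / 4 * (1 / 2) ^ (j + 1) :=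
      (measureReal_biUnion_finset_le _ _).trans
        (Finset.sum_le_sum fun j hj => hP₁ j (Finset.mem_range.1 hj))
    have h3 : ∑ j ∈ Finset.range J, δ / 4 * (1 / 2 : ℝ) ^ (j + 1) ≤ δ / 4 := by
      have h4 : ∑ j ∈ Finset.range J, δ / 4 * (1 / 2 : ℝ) ^ (j + 1) =
          δ / 4 * (1 - (1 / 2) ^ J) := by
        simp only [pow_succ, ← mul_assoc, ← Finset.sum_mul, ← Finset.mul_sum]
        rw [geom_sum_eq (by norm_num)]; ring
      rw [h4]
      exact mul_le_of_le_one_right (by positivity)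
        (by linarith [show (0 : ℝ) < (1 / 2) ^ J by positivity])
    rw [pow_zero, mul_one] at hP₀
    linarith
  · intro S hS θ
    simp only [Set.mem_union, not_or] at hS
    obtain ⟨⟨hS₀, hS₁⟩, hS₂⟩ := hS
    have hNn : (0 : ℝ) ≤ N := Nat.cast_nonneg N
    have hchain : ∀ j ≤ J, |centeredSum μ (φ (rep j (key j θ))) S| ≤
        N * ∑ i ∈ Finset.range (j + 1), u i := by
      intro j
      induction j with
      | zero =>
        intro _
        by_contra! h
        refine hS₀ (Set.mem_biUnion (x := key 0 θ) (hkey 0 θ) ?_)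
        simpa using h.le
      | succ j ih =>
        intro hj
        have hlink : |centeredSum μ (Y j (key (j + 1) θ, key j θ)) S| ≤ N * u (j + 1) := by
          by_contra! h
          refine hS₁ (Set.mem_biUnion (x := j) (Finset.mem_coe.2 (Finset.mem_range.2 hj))
            (Set.mem_biUnion (x := (key (j + 1) θ, key j θ)) (Finset.mem_coe.2
              (Finset.mem_filter.2 ⟨Finset.mem_product.2 ⟨hkey _ θ, hkey _ θ⟩, ?_⟩)) h.le))
          have hpt : ∀ ω, |Y j (key (j + 1) θ, key j θ) ω| ≤
              (e (j + 1) (key (j + 1) θ)).indicator (1 : Ω → ℝ) ω +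
                (e j (key j θ)).indicator (1 : Ω → ℝ) ω := by
            intro ω
            have hnn : ∀ E : Set Ω, 0 ≤ E.indicator (1 : Ω → ℝ) ω := fun E =>
              Set.indicator_nonneg (fun _ _ => zero_le_one) ω
            have hone := hY1 j (key (j + 1) θ, key j θ) ω
            by_cases h1 : ω ∈ e (j + 1) (key (j + 1) θ)
            · rw [Set.indicator_of_mem h1, Pi.one_apply]
              linarith [hnn (e j (key j θ))]
            by_cases h2 : ω ∈ e j (key j θ)
            · rw [Set.indicator_of_mem h2, Pi.one_apply]
              linarith [hnn (e (j + 1) (key (j + 1) θ))]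
            · have h3 := hφe (j + 1) θ _ ω (hrepkey (j + 1) θ).symm h1
              have h4 := hφe j θ _ ω (hrepkey j θ).symm h2
              simp only [hY, ← h3, ← h4, sub_self, abs_zero]
              exact add_nonneg (hnn _) (hnn _)
          have hi1 : Integrable ((e (j + 1) (key (j + 1) θ)).indicator (1 : Ω → ℝ)) μ :=
            (integrable_const (1 : ℝ)).indicator (hem _ _)
          have hi2 : Integrable ((e j (key j θ)).indicator (1 : Ω → ℝ)) μ :=
            (integrable_const (1 : ℝ)).indicator (hem _ _)
          calc ∫ ω, |Y j (key (j + 1) θ, key j θ) ω| ∂μ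
              ≤ ∫ ω, ((e (j + 1) (key (j + 1) θ)).indicator (1 : Ω → ℝ) ω +
                (e j (key j θ)).indicator (1 : Ω → ℝ) ω) ∂μ :=
                integral_mono ((hφi _).sub (hφi _)).abs (hi1.add hi2) hpt
            _ = μ.real (e (j + 1) (key (j + 1) θ)) + μ.real (e j (key j θ)) := by
                rw [integral_add hi1 hi2, integral_indicator_one (hem _ _),
                  integral_indicator_one (hem _ _)]
            _ ≤ (1 / 2) ^ (j + 1) + (1 / 2) ^ j := add_le_add (heμ _ _) (heμ _ _)
            _ = r (j + 1) := by simp only [hr]; ring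
        have hsub := centeredSum_sub (hφi (rep (j + 1) (key (j + 1) θ)))
          (hφi (rep j (key j θ))) S
        have heq : centeredSum μ (φ (rep (j + 1) (key (j + 1) θ))) S =
            centeredSum μ (Y j (key (j + 1) θ, key j θ)) S +
              centeredSum μ (φ (rep j (key j θ))) S := by
          simp only [hY]; rw [hsub]; ring
        rw [heq, Finset.sum_range_succ, mul_add, add_comm]
        exact (abs_add_le _ _).trans (by linarith [ih (by omega)])
    have hlast : |centeredSum μ ((e J (key J θ)).indicator 1) S| ≤ N * u J := by
      by_contra! h
      exact hS₂ (Set.mem_biUnion (x := key J θ) (hkey J θ) h.le)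
    -- Beyond level `J` the difference is dominated by the indicator of the last bracket. The total,
    -- divided by `N`, is at most `ε / 4 + ε / 16 + 2 * (ε / 16) ≤ ε / 2`.
    have hbracket := abs_centeredSum_le_of_indicator (μ := μ)
      (Y := fun ω => φ θ ω - φ (rep J (key J θ)) ω) (hem J (key J θ)) (fun ω => by
        by_cases h1 : ω ∈ e J (key J θ)
        · rw [Set.indicator_of_mem h1, Pi.one_apply]
          exact hφd _ _ ω
        · rw [hφe J θ _ ω (hrepkey J θ).symm h1, sub_self, abs_zero]
          exact Set.indicator_nonneg (fun _ _ => zero_le_one) ω) S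
    rw [centeredSum_sub (hφi _) (hφi _)] at hbracket
    have hsum : ∑ i ∈ Finset.range (J + 1), u i ≤ ε / 4 := by
      simp only [hu, ← Finset.mul_sum]
      have h1 : ∑ i ∈ Finset.range (J + 1), (3 / 4 : ℝ) ^ i ≤ 4 := by
        rw [geom_sum_eq (by norm_num), div_le_iff_of_neg (by norm_num)]
        linarith [show (0 : ℝ) < (3 / 4) ^ (J + 1) by positivity]
      linarith [mul_le_mul_of_nonneg_left h1 (by positivity : 0 ≤ ε / 16)]
    have huJ : u J ≤ ε / 16 :=
      mul_le_of_le_one_right (by positivity) (pow_le_one₀ (by norm_num) (by norm_num))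
    have h1 := hchain J le_rfl
    have h2 := mul_le_mul_of_nonneg_left hsum hNn
    have h3 := mul_le_mul_of_nonneg_left huJ hNn
    have h4 := mul_le_mul_of_nonneg_left ((heμ J (key J θ)).trans hJ1) hNn
    have h5 := (le_abs_self _).trans hlast
    have h6 : |centeredSum μ (φ θ) S| ≤
        |centeredSum μ (φ θ) S - centeredSum μ (φ (rep J (key J θ))) S| +
          |centeredSum μ (φ (rep J (key J θ))) S| := by
      simpa using abs_add_le (centeredSum μ (φ θ) S - centeredSum μ (φ (rep J (key J θ))) S)
        (centeredSum μ (φ (rep J (key J θ))) S)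
    have h7 : 0 ≤ N * ε := mul_nonneg hNn hε.le
    linarith

end Chaining

/-! ### Finitely many patterns, and measurability. -/

namespace TopDown

variable {X : Type u} {c n : ℕ}

/-- The values of the node functions at the examples, and the labels. -/
def pattern (F : Finset (X → Bool)) (D : Dataset X c n) :
    (Fin n → F → Bool) × (Fin n → Fin c) :=
  (fun i f => f.1 (D.1 i), D.2)

theorem samePattern_of_pattern_eq {F : Finset (X → Bool)} {D D' : Dataset X c n}
    (h : pattern F D = pattern F D') : SamePattern F D D' :=
  ⟨(Prod.ext_iff.1 h).2, fun i f hf => congrFun (congrFun (Prod.ext_iff.1 h).1 i) ⟨f, hf⟩⟩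

/-- Such a map factors through a measurable map into a finite space with measurable singletons, so
nothing need be known about the measurability of tie-breaking. -/
theorem measurable_of_pattern [MeasurableSpace X] {F : Finset (X → Bool)}
    (hF : ∀ f ∈ F, Measurable f) {γ : Type*} [MeasurableSpace γ] {Φ : Dataset X c n → γ}
    (hΦ : ∀ D D', pattern F D = pattern F D' → Φ D = Φ D') : Measurable Φ := by
  have hp : Measurable (pattern F : Dataset X c n → _) := by
    refine Measurable.prodMk (measurable_pi_lambda _ fun i => measurable_pi_lambda _ fun f => ?_)
      measurable_snd
    exact (hF f.1 f.2).comp ((measurable_pi_apply i).comp measurable_fst)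
  intro s _
  have : Φ ⁻¹' s = pattern F ⁻¹' (pattern F '' (Φ ⁻¹' s)) := by
    refine Set.Subset.antisymm (Set.subset_preimage_image _ _) ?_
    rintro D ⟨D', hD', h⟩
    rw [Set.mem_preimage, ← hΦ _ _ h]
    exact hD'
  rw [this]
  exact hp (Set.toFinite _).measurableSet

/-- A representative of the datasets with the same pattern as `D`. -/
noncomputable def representative (F : Finset (X → Bool)) (D : Dataset X c n) : Dataset X c n :=
  Set.rangeSplitting (pattern F) ⟨pattern F D, Set.mem_range_self D⟩

theorem pattern_representative (F : Finset (X → Bool)) (D : Dataset X c n) :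
    pattern F (representative F D) = pattern F D :=
  Set.apply_rangeSplitting (pattern F) _

theorem representative_congr {F : Finset (X → Bool)} {D D' : Dataset X c n}
    (h : pattern F D = pattern F D') : representative F D = representative F D' := by
  simp only [representative, h]

theorem finite_range_representative (F : Finset (X → Bool)) :
    (Set.range (representative F : Dataset X c n → _)).Finite :=
  (Set.finite_range (Set.rangeSplitting (pattern F : Dataset X c n → _))).subset
    (Set.range_subset_iff.2 fun _ => Set.mem_range_self _)

end TopDown

/-! ### The Tsallis loss: minimizers, complexity and uniform deviation. -/

open TopDown

section Loss

variable {X : Type u} {c n : ℕ} (tb : TieBreaking X c) {F : Finset (X → Bool)} (C : ℝ → ℕ → ℝ)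
  (s : ℕ)

theorem tsallisLoss_congr (hF : F.Nonempty) (α : ℝ) (β : ℕ) {D D' : Dataset X c n}
    (h : pattern F D = pattern F D') :
    tsallisLoss tb F C s α β D = tsallisLoss tb F C s α β D' := by
  have hp := samePattern_of_pattern_eq h
  unfold tsallisLoss
  rw [hp.learn_eq hF, hp.zeroOneLoss_eq (nodesIn_learn tb hF _ D' s)]

theorem tsallisLoss_mem_image (F : Finset (X → Bool)) (α : ℝ) (β : ℕ) (D : Dataset X c n) :
    tsallisLoss tb F C s α β D ∈ (fun k : ℕ => (k : ℝ) / n) '' Set.Iic n :=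
  ⟨_, (Finset.card_le_univ _).trans (Fintype.card_fin n).le, rfl⟩

theorem tsallisLoss_nonneg (F : Finset (X → Bool)) (α : ℝ) (β : ℕ) (D : Dataset X c n) :
    0 ≤ tsallisLoss tb F C s α β D := by
  unfold tsallisLoss zeroOneLoss; positivity

theorem tsallisLoss_le_one (F : Finset (X → Bool)) (α : ℝ) (β : ℕ) (D : Dataset X c n) :
    tsallisLoss tb F C s α β D ≤ 1 := by
  obtain ⟨k, hk, h⟩ := tsallisLoss_mem_image tb C s F α β D
  rw [← h]
  exact div_le_one_of_le₀ (Nat.cast_le.2 hk) (Nat.cast_nonneg _)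

/-- Any functional of the loss function has a minimizer, as only finitely many loss functions
occur. -/
theorem exists_isArgminParam (hF : F.Nonempty) {B : ℕ} (hB : 1 ≤ B)
    (Ψ : (Dataset X c n → ℝ) → ℝ) :
    ∃ a b, IsArgminParam B (fun α β => Ψ (tsallisLoss tb F C s α β)) a b := by
  set P : Set (ℝ × ℕ) := {p | 0 < p.1 ∧ p.2 ∈ Finset.Icc 1 B} with hP
  set ℓ : ℝ × ℕ → Set.range (pattern F : Dataset X c n → _) → ℝ := fun p q =>
    tsallisLoss tb F C s p.1 p.2 (Set.rangeSplitting (pattern F) q) with hℓ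
  set H : (Set.range (pattern F : Dataset X c n → _) → ℝ) → ℝ := fun g =>
    Ψ fun D => g ⟨pattern F D, Set.mem_range_self D⟩ with hH
  have hval : ∀ p, H (ℓ p) = Ψ (tsallisLoss tb F C s p.1 p.2) := by
    intro p
    simp only [hH, hℓ]
    congr 1
    funext D
    exact tsallisLoss_congr tb C s hF _ _ (Set.apply_rangeSplitting (pattern F) _)
  -- There are finitely many patterns, and every value lies in the finite set of `k / n` with `k ≤
  -- n`.
  have hfin : (ℓ '' P).Finite := by
    refine (Set.Finite.pi' fun _ => (Set.finite_Iic n).image fun k : ℕ => (k : ℝ) / n).subset ?_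
    rintro _ ⟨p, -, rfl⟩ q
    exact tsallisLoss_mem_image tb C s F _ _ _
  have hne : (ℓ '' P).Nonempty :=
    Set.Nonempty.image _ ⟨(1, 1), one_pos, Finset.mem_Icc.2 ⟨le_rfl, hB⟩⟩
  obtain ⟨_, ⟨p, hp, rfl⟩, hmin⟩ := Set.exists_min_image (ℓ '' P) H hfin hne
  refine ⟨p.1, p.2, hp.1, hp.2, fun α hα β hβ => ?_⟩
  have := hmin _ (Set.mem_image_of_mem ℓ (show (α, β) ∈ P from ⟨hα, hβ⟩))
  rwa [hval, hval] at this

/-- A bound on the number of breakpoints in `α` of the loss. -/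
def breakpointBound (m f B c : ℕ) : ℕ :=
  m * ((m * f) ^ m * ((m * f) * (m * f) * (2 * (m + 1) * (B + 1) ^ c))) + 1

/-- The constant is `13 = 4 + 9`: the power contributes `t + 3 ≤ 4 t` copies of `log m + log f`, and
all other terms are at most `9 Q + 2 log t`. Numerical constants are absorbed by `log 2 ≤ log (B +
c)`. -/
theorem log_breakpointBound_le {t f B c : ℕ} (ht : 1 ≤ t) (hf : 1 ≤ f) (hB : 1 ≤ B)
    (hc : 1 ≤ c) :
    Real.log (B * (2 * breakpointBound (t + 1) f B c + 1)) ≤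
      13 * (t * (Real.log f + Real.log t + c * Real.log (B + c))) := by
  have ht' : (1 : ℝ) ≤ t := by exact_mod_cast ht
  have hf' : (1 : ℝ) ≤ f := by exact_mod_cast hf
  have hB' : (1 : ℝ) ≤ B := by exact_mod_cast hB
  have hc' : (1 : ℝ) ≤ c := by exact_mod_cast hc
  set m : ℝ := t + 1 with hm
  set y : ℝ := m * ((m * f) ^ (t + 1) * ((m * f) * (m * f) * (2 * (m + 1) * (B + 1 : ℝ) ^ c)))
    with hy
  have hm0 : 1 ≤ m := by linarith
  have hmf : 1 ≤ m * f := one_le_mul_of_one_le_of_one_le hm0 hf'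
  have hy1 : 1 ≤ y := by
    refine one_le_mul_of_one_le_of_one_le hm0 (one_le_mul_of_one_le_of_one_le
      (one_le_pow₀ hmf) (one_le_mul_of_one_le_of_one_le
        (one_le_mul_of_one_le_of_one_le hmf hmf) (one_le_mul_of_one_le_of_one_le (by linarith)
          (one_le_pow₀ (by linarith)))))
  have hcast : (breakpointBound (t + 1) f B c : ℝ) = y + 1 := by
    simp only [breakpointBound, hy, hm]; push_cast; ring
  have hlog2 : 0 < Real.log 2 := Real.log_pos (by norm_num)
  have hlogf : 0 ≤ Real.log f := Real.log_nonneg hf'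
  have hlogt : 0 ≤ Real.log t := Real.log_nonneg ht'
  set Q : ℝ := c * Real.log (B + c) with hQ
  have hlogBc : 0 ≤ Real.log (B + c) := Real.log_nonneg (by linarith)
  have hQ0 : Real.log (B + c) ≤ Q := le_mul_of_one_le_left hlogBc hc'
  have hQ2 : Real.log 2 ≤ Q := (Real.log_le_log (by norm_num) (by linarith)).trans hQ0
  have hQB : Real.log B ≤ Q := (Real.log_le_log (by linarith) (by linarith)).trans hQ0
  have hQB1 : c * Real.log (B + 1) ≤ Q :=
    mul_le_mul_of_nonneg_left (Real.log_le_log (by linarith) (by linarith)) (by linarith)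
  have hlogm : Real.log m ≤ Real.log 2 + Real.log t := by
    rw [← Real.log_mul (by norm_num) (by linarith)]
    exact Real.log_le_log (by linarith) (by linarith)
  have hlogm1 : Real.log (m + 1) ≤ 2 * Real.log 2 + Real.log t := by
    rw [two_mul, ← Real.log_mul (by norm_num) (by norm_num),
      ← Real.log_mul (by norm_num) (by linarith)]
    exact Real.log_le_log (by linarith) (by linarith)
  have hlog5 : Real.log 5 ≤ 3 * Real.log 2 := by
    rw [show (3 : ℝ) * Real.log 2 = Real.log (2 ^ 3) by rw [Real.log_pow]; norm_num]
    exact Real.log_le_log (by norm_num) (by norm_num)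
  have hmain : Real.log (B * (2 * breakpointBound (t + 1) f B c + 1)) ≤
      Real.log (5 * (B * y)) := by
    rw [hcast]
    refine Real.log_le_log (by positivity) ?_
    nlinarith
  have hly : Real.log (5 * (B * y)) = Real.log 5 + Real.log B + Real.log m +
      (t + 3) * (Real.log m + Real.log f) + Real.log 2 + Real.log (m + 1) +
        c * Real.log (B + 1) := by
    have hB0 : (B : ℝ) ≠ 0 := by linarith
    have hB1 : (B : ℝ) + 1 ≠ 0 := by linarith
    have hm1 : m ≠ 0 := by linarith
    have hm2 : m + 1 ≠ 0 := by linarith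
    have hf0 : (f : ℝ) ≠ 0 := by linarith
    rw [hy, Real.log_mul (by norm_num) (by positivity), Real.log_mul hB0 (by positivity),
      Real.log_mul hm1 (by positivity), Real.log_mul (by positivity) (by positivity),
      Real.log_mul (by positivity) (by positivity), Real.log_mul (by positivity) (by positivity),
      Real.log_mul (by positivity) (by positivity), Real.log_mul (by positivity) (by positivity),
      Real.log_mul (by norm_num) hm2,
      Real.log_pow, Real.log_pow, Real.log_mul hm1 hf0]
    push_cast; ring
  rw [hly] at hmain
  have h1 : (t + 3) * (Real.log m + Real.log f) ≤ 4 * t * (Q + Real.log t + Real.log f) :=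
    mul_le_mul (by linarith) (by linarith) (add_nonneg (Real.log_nonneg hm0) hlogf)
      (by linarith)
  have h2 : 9 * Q + 2 * Real.log t ≤ 9 * (t * (Q + Real.log t + Real.log f)) := by
    have : Q + Real.log t + Real.log f ≤ t * (Q + Real.log t + Real.log f) :=
      le_mul_of_one_le_left (by linarith) ht'
    linarith
  linarith

/-- For each `β`, the loss has brackets in `α`. -/
theorem exists_brackets_tsallisLoss [MeasurableSpace X] (𝒟 : Measure (Dataset X c n))
    [IsProbabilityMeasure 𝒟] (hF : F.Nonempty) (hFm : ∀ f ∈ F, Measurable f) {B m : ℕ}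
    (hs : s ≤ m) {b : ℕ} (hb : b ∈ Finset.Icc 1 B) (hC : ∀ α, 0 < α → 0 < C α b) {γ : ℝ}
    (hγ : 0 < γ) :
    ∃ (key : ℝ → ℕ) (e : ℕ → Set (Dataset X c n)),
      (∀ x, (key x : ℝ) ≤ 2 * breakpointBound m F.card B c / γ) ∧
      (∀ k, MeasurableSet (e k)) ∧ (∀ k, 𝒟.real (e k) ≤ γ) ∧
      ∀ x y D, 0 < x → 0 < y → key x = key y → D ∉ e (key x) →
        tsallisLoss tb F C s x b D = tsallisLoss tb F C s y b D := by
  classical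
  choose A hA hlearn using fun D : Dataset X c n => exists_breakpoints_learn tb hF D b hs
  refine exists_brackets (μ := 𝒟) (φ := fun x D => tsallisLoss tb F C s x b D)
    -- Breakpoints chosen at the representative depend on the pattern alone, which makes `{D | a ∈ A
    -- D}` measurable and puts all breakpoints into one finite set.
    (A := fun D => A (representative F D))
    (U := (finite_range_representative F).toFinset.biUnion A)
    (M := breakpointBound m F.card B c) (fun D => ?_) (fun D => ?_) (fun a => ?_) ?_ hγ
  · refine (hA _).trans ?_
    unfold breakpointBound
    have := (Finset.mem_Icc.1 hb).2
    gcongr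
  · exact Finset.subset_biUnion_of_mem A
      (by rw [Set.Finite.mem_toFinset]; exact Set.mem_range_self D)
  · have : Measurable fun D : Dataset X c n => (a ∈ A (representative F D) : Prop) :=
      measurable_of_pattern hFm fun D D' h => by rw [representative_congr h]
    exact measurableSet_setOfPred.2 this
  · intro D x y hx hxy hz
    have hp := pattern_representative F D
    simp only [← tsallisLoss_congr tb C s hF _ b hp]
    unfold tsallisLoss
    rw [hlearn _ x y hx hxy hz _ _ (hC x hx) (hC y (hx.trans hxy))]

/-- The finitely many `β` are made part of the bracket index, so `V = B (2 M + 1)`: for `γ ≤ 1`,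
each `β` needs at most `2 M / γ + 1 ≤ (2 M + 1) / γ` cells. -/
theorem exists_bad_tsallisLoss [MeasurableSpace X] (𝒟 : Measure (Dataset X c n))
    [IsProbabilityMeasure 𝒟] (hF : F.Nonempty) (hFm : ∀ f ∈ F, Measurable f) {B t : ℕ}
    (hc : 1 ≤ c) (ht : 1 ≤ t) (hB : 1 ≤ B) (hs : s ≤ t + 1)
    (hC : ∀ α, 0 < α → ∀ β ∈ Finset.Icc 1 B, 0 < C α β) {ε δ : ℝ} (hε : 0 < ε) (hε1 : ε ≤ 1)
    (hδ : 0 < δ) (hδ1 : δ ≤ 1) {N : ℕ}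
    (hN : 13000000 / ε ^ 2 * (t * (Real.log F.card + Real.log t + c * Real.log (B + c))
      + Real.log (1 / δ)) ≤ N) :
    ∃ bad : Set (Fin N → Dataset X c n), (Measure.pi fun _ : Fin N => 𝒟).real bad ≤ δ ∧
      ∀ S, S ∉ bad → ∀ α, 0 < α → ∀ β ∈ Finset.Icc 1 B,
        |centeredSum 𝒟 (tsallisLoss tb F C s α β) S| ≤ N * (ε / 2) := by
  have hB' : (1 : ℝ) ≤ B := by exact_mod_cast hB
  have hM : (1 : ℝ) ≤ breakpointBound (t + 1) F.card B c := by
    exact_mod_cast Nat.le_add_left 1 _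
  set V : ℝ := B * (2 * breakpointBound (t + 1) F.card B c + 1) with hV
  have hV2 : 2 ≤ V := by nlinarith
  have hN' : 1000000 * (Real.log V + Real.log (1 / δ)) ≤ N * ε ^ 2 := by
    have hlog := log_breakpointBound_le ht hF.card_pos hB hc
    have hld : 0 ≤ Real.log (1 / δ) := Real.log_nonneg (by rw [le_div_iff₀ hδ]; linarith)
    rw [div_mul_eq_mul_div, div_le_iff₀ (by positivity)] at hN
    linarith
  refine (exists_bad_of_brackets (μ := 𝒟) (N := N)
    (Θ := {α : ℝ // 0 < α} × Finset.Icc 1 B) (ι := Finset.Icc 1 B × ℕ)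
    (φ := fun θ => tsallisLoss tb F C s θ.1.1 θ.2.1)
    (fun θ => measurable_of_pattern hFm fun D D' h => tsallisLoss_congr tb C s hF _ _ h)
    (fun θ D => tsallisLoss_nonneg tb C s F _ _ D)
    (fun θ D => tsallisLoss_le_one tb C s F _ _ D) hV2 ?_ hε hε1 hδ hδ1 hN').imp
    fun bad h => ⟨h.1, fun S hS α hα β hβ => h.2 S hS (⟨α, hα⟩, ⟨β, hβ⟩)⟩
  intro γ hγ hγ1
  choose key e hkey hem heμ hφ using fun b : Finset.Icc 1 B =>
    exists_brackets_tsallisLoss tb C s 𝒟 hF hFm hs b.2 (fun α hα => hC α hα b.1 b.2) hγ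
  refine ⟨fun θ => (θ.2, key θ.2 θ.1.1), Finset.univ ×ˢ Finset.range
    (⌊2 * breakpointBound (t + 1) F.card B c / γ⌋₊ + 1), fun i => e i.1 i.2, fun θ => ?_, ?_,
    fun i => hem _ _, fun i => heμ _ _, ?_⟩
  · simp only [Finset.mem_product, Finset.mem_univ, true_and, Finset.mem_range,
      Nat.lt_succ_iff]
    exact Nat.le_floor (hkey _ _)
  · rw [Finset.card_product, Finset.card_range, Finset.card_univ, Fintype.card_coe,
      Nat.card_Icc, Nat.add_sub_cancel]
    push_cast
    rw [hV, mul_div_assoc (B : ℝ), add_div]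
    refine mul_le_mul_of_nonneg_left (add_le_add (Nat.floor_le (by positivity)) ?_)
      (by positivity)
    rw [le_div_iff₀ hγ]; linarith
  · rintro ⟨⟨x, hx⟩, b⟩ ⟨⟨y, hy⟩, b'⟩ D hk hD
    simp only [Prod.mk.injEq] at hk
    obtain ⟨rfl, hk⟩ := hk
    exact hφ b x y D hx hy hk hD

end Loss

/-! ### Empirical risk minimization. -/

theorem mainTheorem1 :
    ∃ K : ℝ, 0 < K ∧
      ∀ (X : Type u) [MeasurableSpace X] (c n t B s : ℕ),
        1 ≤ c → 1 ≤ t → 1 ≤ B → s ≤ t + 1 →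
      ∀ (F : Finset (X → Bool)), F.Nonempty → (∀ f ∈ F, Measurable f) →
      ∀ (tb : TieBreaking X c) (C : ℝ → ℕ → ℝ),
        (∀ α : ℝ, 0 < α → ∀ β ∈ Finset.Icc 1 B, 0 < C α β) →
      ∀ (𝒟 : Measure (Dataset X c n)) [IsProbabilityMeasure 𝒟],
        (∃ (a : ℝ) (b : ℕ),
          IsArgminParam B (fun α β => ∫ D, tsallisLoss tb F C s α β D ∂𝒟) a b) ∧
        ∀ (N : ℕ),
          (∀ S : Fin N → Dataset X c n, ∃ (a : ℝ) (b : ℕ),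
            IsArgminParam B (fun α β => ∑ j, tsallisLoss tb F C s α β (S j)) a b) ∧
          ∀ (ε δ : ℝ), 0 < ε → 0 < δ →
            K / ε ^ 2 * (t * (Real.log F.card + Real.log t + c * Real.log (B + c))
              + Real.log (1 / δ)) ≤ N →
            1 - δ ≤ (Measure.pi fun _ : Fin N => 𝒟).real
              {S | ∀ (αhat : ℝ) (βhat : ℕ),
                IsArgminParam B (fun α β => ∑ j, tsallisLoss tb F C s α β (S j)) αhat βhat →
                ∀ (αbest : ℝ) (βbest : ℕ),
                IsArgminParam B (fun α β => ∫ D, tsallisLoss tb F C s α β D ∂𝒟) αbest βbest →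
                ∫ D, tsallisLoss tb F C s αhat βhat D ∂𝒟 ≤
                  ∫ D, tsallisLoss tb F C s αbest βbest D ∂𝒟 + ε} := by
  refine ⟨13000000, by norm_num, ?_⟩
  intro X _ c n t B s hc ht hB hs F hF hFm tb C hC 𝒟 _
  refine ⟨exists_isArgminParam tb C s hF hB fun g => ∫ D, g D ∂𝒟, fun N =>
    ⟨fun S => exists_isArgminParam tb C s hF hB fun g => ∑ j, g (S j), ?_⟩⟩
  intro ε δ hε hδ hN
  rcases le_or_gt 1 δ with hδ1 | hδ1
  · exact (sub_nonpos.2 hδ1).trans measureReal_nonneg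
  rcases le_or_gt 1 ε with hε1 | hε1
  · have huniv : ∀ G : Set (Fin N → Dataset X c n), G = Set.univ →
        1 - δ ≤ (Measure.pi fun _ : Fin N => 𝒟).real G := by
      rintro _ rfl
      rw [probReal_univ]; linarith
    refine huniv _ (Set.eq_univ_of_forall fun S αhat βhat _ αbest βbest _ => ?_)
    have h1 : ∫ D, tsallisLoss tb F C s αhat βhat D ∂𝒟 ≤ 1 := by
      calc ∫ D, tsallisLoss tb F C s αhat βhat D ∂𝒟 ≤ ∫ _D, (1 : ℝ) ∂𝒟 :=
            integral_mono_of_nonneg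
              (Filter.Eventually.of_forall (tsallisLoss_nonneg tb C s F _ _))
              (integrable_const _) (Filter.Eventually.of_forall (tsallisLoss_le_one tb C s F _ _))
        _ = 1 := by simp
    have h2 : 0 ≤ ∫ D, tsallisLoss tb F C s αbest βbest D ∂𝒟 :=
      integral_nonneg (tsallisLoss_nonneg tb C s F _ _)
    linarith
  · obtain ⟨bad, hbad, h⟩ := exists_bad_tsallisLoss tb C s 𝒟 hF hFm hc ht hB hs hC hε hε1.le hδ
      hδ1.le hN
    have hNpos : (0 : ℝ) < N := by
      have ht' : (1 : ℝ) ≤ t := by exact_mod_cast ht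
      have hB' : (1 : ℝ) ≤ B := by exact_mod_cast hB
      have hc' : (1 : ℝ) ≤ c := by exact_mod_cast hc
      have hlog : 0 ≤ Real.log F.card := Real.log_natCast_nonneg _
      have hlogt : 0 ≤ Real.log t := Real.log_natCast_nonneg _
      have hlogB : 0 ≤ Real.log (B + c) := Real.log_nonneg (by linarith)
      have hlogδ : 0 < Real.log (1 / δ) := Real.log_pos (by rw [lt_div_iff₀ hδ]; linarith)
      exact lt_of_lt_of_le (by positivity) hN
    -- Subadditivity on `bad ∪ G` replaces the complement rule, so neither set has to be measurable.
    have hcover : ∀ G : Set (Fin N → Dataset X c n), badᶜ ⊆ G →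
        1 - δ ≤ (Measure.pi fun _ : Fin N => 𝒟).real G := by
      intro G hG
      have h1 : (Measure.pi fun _ : Fin N => 𝒟).real (bad ∪ G) = 1 := by
        rw [show bad ∪ G = Set.univ from Set.eq_univ_of_forall fun S => by
          by_cases hS : S ∈ bad
          · exact Or.inl hS
          · exact Or.inr (hG hS), probReal_univ]
      have h2 := measureReal_union_le (μ := Measure.pi fun _ : Fin N => 𝒟) bad G
      linarith
    refine hcover _ fun S hS αhat βhat hhat αbest βbest hbest => ?_
    -- Risk at the empirical minimizer exceeds its empirical mean by at most `ε / 2`, and the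
    -- empirical mean at the best parameters exceeds their risk by at most `ε / 2`.
    have h1 := (abs_le.1 (h S hS αhat hhat.1 βhat hhat.2.1)).1
    have h2 := (abs_le.1 (h S hS αbest hbest.1 βbest hbest.2.1)).2
    have h3 := hhat.2.2 αbest hbest.1 βbest hbest.2.1
    unfold centeredSum at h1 h2
    refine le_of_mul_le_mul_left ?_ hNpos
    rw [mul_add]
    linarith
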